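/- Let $R\subset\mathbb{R}^N$ be a finite reduced root system: a finite set of nonzero vectors such that $u,v\in R$ implies $u\sigma_v\in R$, where $x\sigma_v=x-2\frac{\langle x,v\rangle}{|v|^2}v$, and such that $u,cu\in R$ implies $c=\pm1$. Let $W(R)$ be the group generated by the reflections $\sigma_v$, $v\in R$. Fix $u_0\in\mathbb{R}^N$ with $\langle u_0,v\rangle\ne0$ for all $v\in R$, and put $R_+=\{v\in R:\langle u_0,v\rangle>0\}$. Let $\kappa:R\to[0,\infty)$, $v\mapsto\kappa_v$, be constant on the $W(R)$-orbits in $R$, let $\omega>0$, and put $\gamma_\kappa=\sum_{v\in R_+}\kappa_v$ and $h_\kappa(x)=\prod_{v\in R_+}|\langle x,v\rangle|^{\kappa_v}$. On $\mathcal{P}=\mathbb{R}[x_1,\dots,x_N]$ define, for $1\le i\le N$, $$\mathcal{D}_ip(x)=\frac{\partial p}{\partial x_i}(x)+\sum_{v\in R_+}\kappa_v\frac{p(x)-p(x\sigma_v)}{\langle x,v\rangle}v_i,\qquad \Delta_\kappa=\sum_{i=1}^N\mathcal{D}_i^2,\qquad \delta=\sum_{i=1}^N x_i\frac{\partial}{\partial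 x_i},$$ and let $$\widetilde{\mathcal{H}}=-\Delta_\kappa+\omega(N+2\gamma_\kappa+2\delta),\qquad E_n=\omega(N+2\gamma_\kappa+2n)\quad(n=0,1,2,\dots).$$ For $p,q\in\mathcal{P}$ let $$\langle p,q\rangle_2=c_{\kappa,\omega}\int_{\mathbb{R}^N}p(x)q(x)e^{-\omega|x|^2}h_\kappa(x)^2\,dx,\qquad c_{\kappa,\omega}^{-1}=\int_{\mathbb{R}^N}e^{-\omega|x|^2}h_\kappa(x)^2\,dx,$$ $$\langle p,q\rangle_{\kappa,\omega}=p\Big(\tfrac{1}{2\omega}\mathcal{D}_1,\dots,\tfrac{1}{2\omega}\mathcal{D}_N\Big)q(x)\Big|_{x=0},$$ and let $\pi_np$ denote the homogeneous component of $p$ of degree $n$. **Theorem.** Let $n,k\ge0$ be integers and let $p,q\in\mathcal{P}$ satisfy $\widetilde{\mathcal{H}}p=E_np$ and $\widetilde{\mathcal{H}}q=E_kq$. If $n=k$, then $\langle p,q\rangle_2=\langle\pi_np,\pi_nq\rangle_{\kappa,\omega}$. If $n\neq k$, then $\langle p,q\rangle_2=0$. -/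

import Mathlib

open MeasureTheory

noncomputable section

namespace DunklOsc

/-- The Euclidean space `ℝ^N`. -/
abbrev Space (N : ℕ) := EuclideanSpace ℝ (Fin N)

/-- The real polynomials in `x_1, …, x_N`. -/
abbrev Poly (N : ℕ) := MvPolynomial (Fin N) ℝ

variable {N : ℕ}

/-! ### Root systems -/

/-- The orthogonal reflection `x ↦ x - 2 (⟨x, v⟩ / |v|²) v` along `v`
(the formula is `refl_apply`). -/
def refl (v : Space N) : Space N ≃ₗᵢ[ℝ] Space N :=
  (Submodule.span ℝ {v})ᗮ.reflection

/-- A finite reduced root system in `ℝ^N`; it need be neither crystallographic nor spanning. -/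
structure IsRootSystem (R : Finset (Space N)) : Prop where
  ne_zero : ∀ v ∈ R, v ≠ 0
  refl_mem : ∀ u ∈ R, ∀ v ∈ R, refl v u ∈ R
  reduced : ∀ u ∈ R, ∀ c : ℝ, c • u ∈ R → c = 1 ∨ c = -1

/-- The finite reflection group `W(R)` generated by the reflections along the roots. -/
def reflectionGroup (R : Finset (Space N)) : Subgroup (Space N ≃ₗᵢ[ℝ] Space N) :=
  Subgroup.closure {s | ∃ v ∈ R, s = refl v}

/-- `κ` is a multiplicity function on `R`: it is constant on the `W(R)`-orbits of roots.
The values of `κ` outside `R` play no role. -/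
def IsMultiplicity (R : Finset (Space N)) (κ : Space N → ℝ) : Prop :=
  ∀ v ∈ R, ∀ w ∈ reflectionGroup R, κ (w v) = κ v

open Classical in
/-- The positive roots `R₊ = {v ∈ R : ⟨u₀, v⟩ > 0}`. -/
def posRoots (R : Finset (Space N)) (u₀ : Space N) : Finset (Space N) :=
  {v ∈ R | 0 < inner ℝ u₀ v}

/-- `γ_κ = ∑_{v ∈ R₊} κ_v`. -/
def gammaSum (Rp : Finset (Space N)) (κ : Space N → ℝ) : ℝ := ∑ v ∈ Rp, κ v

/-! ### Dunkl operators on polynomials -/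

/-- The value `p(x)` of a polynomial at a point. -/
def evalAt (x : Space N) (p : Poly N) : ℝ := MvPolynomial.eval (fun i => x i) p

/-- The linear polynomial `⟨x, v⟩`. -/
def linForm (v : Space N) : Poly N := ∑ j, MvPolynomial.C (v j) * MvPolynomial.X j

/-- The action `(σ_v p)(x) = p(x σ_v)` of a reflection on polynomials, by the substitution
`x_j ↦ x_j - (2 v_j / |v|²) ⟨x, v⟩` (see `evalAt_reflPoly`). -/
def reflPoly (v : Space N) : Poly N →ₐ[ℝ] Poly N :=
  MvPolynomial.aeval fun j =>
    MvPolynomial.X j - MvPolynomial.C (2 * v j / ‖v‖ ^ 2) * linForm v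

/-- The substitution `x_j ↦ x_j - (2 v_j / |v|²) t` with a new variable `t`. -/
def shiftPoly (v : Space N) : Poly N →ₐ[ℝ] Polynomial (Poly N) :=
  MvPolynomial.aeval fun j =>
    Polynomial.C (MvPolynomial.X j) -
      Polynomial.C (MvPolynomial.C (2 * v j / ‖v‖ ^ 2)) * Polynomial.X

/-- The polynomial `(p(x) - p(x σ_v)) / ⟨x, v⟩`. It is obtained by writing
`p(x - (2 t / |v|²) v) = p(x) + t r(x, t)` and taking `-r(x, ⟨x, v⟩)`;
`linForm_mul_divDiff` and `divDiff_unique` say that it is the quotient. -/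
def divDiff (v : Space N) : Poly N →ₗ[ℝ] Poly N where
  toFun p := -((shiftPoly v p).divX).eval (linForm v)
  map_add' p q := by
    simp only [map_add, Polynomial.divX_add, Polynomial.eval_add]
    ring
  map_smul' c p := by
    have h : shiftPoly v (c • p) = Polynomial.C (MvPolynomial.C c) * shiftPoly v p := by
      rw [map_smul, Algebra.smul_def]
      rfl
    rw [h, Polynomial.divX_C_mul, Polynomial.eval_mul, Polynomial.eval_C,
      MvPolynomial.smul_eq_C_mul, RingHom.id_apply]
    ring

/-- The Dunkl operator
`D_i p(x) = ∂p/∂x_i (x) + ∑_{v ∈ R₊} κ_v (p(x) - p(x σ_v)) / ⟨x, v⟩ · v_i`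
(see `evalAt_dunkl`). -/
def dunkl (Rp : Finset (Space N)) (κ : Space N → ℝ) (i : Fin N) : Module.End ℝ (Poly N) :=
  (MvPolynomial.pderiv i).toLinearMap + ∑ v ∈ Rp, (κ v * v i) • divDiff v

/-- The Dunkl Laplacian `Δ_κ = ∑_i D_i²`. -/
def dunklLaplacian (Rp : Finset (Space N)) (κ : Space N → ℝ) : Module.End ℝ (Poly N) :=
  ∑ i, dunkl Rp κ i ^ 2

/-- The Euler operator `δ = ∑_i x_i ∂/∂x_i`. -/
def euler : Module.End ℝ (Poly N) :=
  ∑ i, LinearMap.mulLeft ℝ (MvPolynomial.X i) ∘ₗ (MvPolynomial.pderiv i).toLinearMap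

/-! ### The conjugated Hamiltonian -/

/-- The conjugated Hamiltonian `-Δ_κ + ω (N + 2 γ_κ + 2 δ)` on polynomials. -/
def conjHamiltonian (Rp : Finset (Space N)) (κ : Space N → ℝ) (ω : ℝ) :
    Module.End ℝ (Poly N) :=
  -dunklLaplacian Rp κ +
    ω • ((N + 2 * gammaSum Rp κ) • (1 : Module.End ℝ (Poly N)) + (2 : ℝ) • euler)

/-- The energy `E_n = ω (N + 2 γ_κ + 2 n)`. -/
def energy (Rp : Finset (Space N)) (κ : Space N → ℝ) (ω : ℝ) (n : ℕ) : ℝ :=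
  ω * (N + 2 * gammaSum Rp κ + 2 * n)

/-! ### The two bilinear forms -/

/-- `h_κ(x) = ∏_{v ∈ R₊} |⟨x, v⟩|^{κ_v}`. -/
def weight (Rp : Finset (Space N)) (κ : Space N → ℝ) (x : Space N) : ℝ :=
  ∏ v ∈ Rp, |inner ℝ x v| ^ κ v

/-- The constant `c_{κ,ω}`, with `c_{κ,ω}⁻¹ = ∫ exp(-ω |x|²) h_κ(x)² dx`
(a positive number by `normIntegral_pos`). -/
def normConst (Rp : Finset (Space N)) (κ : Space N → ℝ) (ω : ℝ) : ℝ :=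
  (∫ x : Space N, Real.exp (-ω * ‖x‖ ^ 2) * weight Rp κ x ^ 2)⁻¹

/-- `⟨p, q⟩₂ = c_{κ,ω} ∫ p(x) q(x) exp(-ω |x|²) h_κ(x)² dx`
(the integral converges by `integrable_gauss`). -/
def integralForm (Rp : Finset (Space N)) (κ : Space N → ℝ) (ω : ℝ) (p q : Poly N) : ℝ :=
  normConst Rp κ ω *
    ∫ x : Space N, evalAt x p * evalAt x q * Real.exp (-ω * ‖x‖ ^ 2) * weight Rp κ x ^ 2

/-- The operator `p(T_1, …, T_N)`, where a monomial `x_1^{m_1} ⋯ x_N^{m_N}` becomes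
`T_1^{m_1} ∘ ⋯ ∘ T_N^{m_N}`. It is used for scaled Dunkl operators, which commute with each
other, so that the order of the factors does not matter. -/
def applyAt (T : Fin N → Module.End ℝ (Poly N)) (p : Poly N) : Module.End ℝ (Poly N) :=
  ∑ m ∈ p.support, p.coeff m • (List.ofFn fun i => T i ^ m i).prod

/-- `⟨p, q⟩_{κ,ω} = p(D_1 / (2ω), …, D_N / (2ω)) q(x) |_{x = 0}`. -/
def algebraicForm (Rp : Finset (Space N)) (κ : Space N → ℝ) (ω : ℝ) (p q : Poly N) : ℝ :=
  evalAt 0 (applyAt (fun i => (1 / (2 * ω)) • dunkl Rp κ i) p q)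

/-! ### The definitions do what they should -/

theorem refl_apply (v x : Space N) :
    refl v x = x - (2 * inner ℝ x v / ‖v‖ ^ 2) • v := by
  rw [refl, Submodule.reflection_orthogonal_apply, Submodule.reflection_singleton_apply]
  rw [real_inner_comm, neg_sub, mul_div_assoc, mul_smul]
  simp [two_smul]

theorem evalAt_linForm (v x : Space N) : evalAt x (linForm v) = inner ℝ x v := by
  simp [evalAt, linForm, PiLp.inner_apply]

theorem evalAt_reflPoly (v x : Space N) (p : Poly N) :
    evalAt x (reflPoly v p) = evalAt (refl v x) p := by
  have hl := evalAt_linForm v x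
  unfold evalAt at *
  induction p using MvPolynomial.induction_on with
  | C a => simp [reflPoly]
  | add p q hp hq => simp only [map_add, hp, hq]
  | mul_X p j hp =>
    simp only [map_mul, hp, MvPolynomial.eval_X]
    congr 1
    simp only [reflPoly, MvPolynomial.aeval_X, map_sub, map_mul, MvPolynomial.eval_X,
      MvPolynomial.eval_C, hl, refl_apply, PiLp.sub_apply, PiLp.smul_apply, smul_eq_mul]
    ring

theorem linForm_mul_divDiff (v : Space N) (p : Poly N) :
    linForm v * divDiff v p = p - reflPoly v p := by
  have h0 : ∀ p : Poly N, (shiftPoly v p).coeff 0 = p := by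
    intro p
    rw [Polynomial.coeff_zero_eq_eval_zero]
    induction p using MvPolynomial.induction_on with
    | C a => simp [shiftPoly, Polynomial.algebraMap_apply]
    | add p q hp hq => simp only [map_add, Polynomial.eval_add, hp, hq]
    | mul_X p j hp =>
      rw [map_mul, Polynomial.eval_mul, hp]
      simp [shiftPoly]
  have h1 : ∀ p : Poly N, (shiftPoly v p).eval (linForm v) = reflPoly v p := by
    intro p
    induction p using MvPolynomial.induction_on with
    | C a => simp [shiftPoly, reflPoly, Polynomial.algebraMap_apply]
    | add p q hp hq => simp only [map_add, Polynomial.eval_add, hp, hq]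
    | mul_X p j hp =>
      rw [map_mul, Polynomial.eval_mul, hp, map_mul]
      simp [shiftPoly, reflPoly]
  have h2 := congrArg (Polynomial.eval (linForm v)) (Polynomial.divX_mul_X_add (shiftPoly v p))
  rw [Polynomial.eval_add, Polynomial.eval_mul, Polynomial.eval_X, Polynomial.eval_C, h0, h1] at h2
  change linForm v * (-((shiftPoly v p).divX).eval (linForm v)) = _
  rw [← h2]
  ring

theorem divDiff_unique {v : Space N} (hv : v ≠ 0) (p r : Poly N)
    (h : linForm v * r = p - reflPoly v p) : r = divDiff v p := by
  have hl : linForm v ≠ 0 := by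
    intro h0
    have h1 := evalAt_linForm v v
    rw [h0] at h1
    have h2 : (0 : ℝ) = ‖v‖ ^ 2 := by simpa [evalAt] using h1
    exact hv (norm_eq_zero.mp (pow_eq_zero_iff two_ne_zero |>.mp h2.symm))
  exact mul_left_cancel₀ hl (h.trans (linForm_mul_divDiff v p).symm)

/-- The Dunkl operator as an operator on functions, off the mirrors. -/
theorem evalAt_dunkl (Rp : Finset (Space N)) (κ : Space N → ℝ) (i : Fin N) (p : Poly N)
    (x : Space N) (hx : ∀ v ∈ Rp, inner ℝ x v ≠ 0) :
    evalAt x (dunkl Rp κ i p) = evalAt x (MvPolynomial.pderiv i p) +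
      ∑ v ∈ Rp, κ v * ((evalAt x p - evalAt (refl v x) p) / inner ℝ x v) * v i := by
  have hd : ∀ v ∈ Rp, evalAt x (divDiff v p) =
      (evalAt x p - evalAt (refl v x) p) / inner ℝ x v := by
    intro v hv
    have h := congrArg (evalAt x) (linForm_mul_divDiff v p)
    rw [eq_div_iff (hx v hv), ← evalAt_linForm, ← evalAt_reflPoly, mul_comm]
    simpa [evalAt] using h
  have h1 : evalAt x (dunkl Rp κ i p) = evalAt x (MvPolynomial.pderiv i p) +
      ∑ v ∈ Rp, (κ v * v i) * evalAt x (divDiff v p) := by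
    simp [dunkl, evalAt, LinearMap.sum_apply, map_sum, MvPolynomial.smul_eval]
  rw [h1]
  congr 1
  refine Finset.sum_congr rfl fun v hv => ?_
  rw [hd v hv]
  ring

theorem continuous_evalAt (p : Poly N) : Continuous fun x : Space N => evalAt x p := by
  unfold evalAt
  exact (MvPolynomial.continuous_eval p).comp (by fun_prop)

theorem continuous_weight (Rp : Finset (Space N)) (κ : Space N → ℝ) (hκ : ∀ v ∈ Rp, 0 ≤ κ v) :
    Continuous (weight Rp κ) := by
  unfold weight
  refine continuous_finsetProd _ fun v hv => ?_
  exact Continuous.rpow_const (by fun_prop) fun x => Or.inr (hκ v hv)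

/-- Functions bounded by `C (1 + |x|)^k`. -/
def PolyBounded (f : Space N → ℝ) : Prop :=
  ∃ C : ℝ, ∃ k : ℕ, ∀ x, |f x| ≤ C * (1 + ‖x‖) ^ k

theorem PolyBounded.mul {f g : Space N → ℝ} (hf : PolyBounded f) (hg : PolyBounded g) :
    PolyBounded fun x => f x * g x := by
  obtain ⟨C, k, hC⟩ := hf
  obtain ⟨D, l, hD⟩ := hg
  refine ⟨C * D, k + l, fun x => ?_⟩
  rw [abs_mul, pow_add]
  calc |f x| * |g x| ≤ (C * (1 + ‖x‖) ^ k) * (D * (1 + ‖x‖) ^ l) :=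
        mul_le_mul (hC x) (hD x) (abs_nonneg _) ((abs_nonneg _).trans (hC x))
    _ = _ := by ring

theorem PolyBounded.add {f g : Space N → ℝ} (hf : PolyBounded f) (hg : PolyBounded g) :
    PolyBounded fun x => f x + g x := by
  obtain ⟨C, k, hC⟩ := hf
  obtain ⟨D, l, hD⟩ := hg
  refine ⟨|C| + |D|, k + l, fun x => ?_⟩
  have h1 : (1 : ℝ) ≤ 1 + ‖x‖ := by linarith [norm_nonneg x]
  have hk : (1 + ‖x‖) ^ k ≤ (1 + ‖x‖) ^ (k + l) := pow_le_pow_right₀ h1 (by omega)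
  have hl : (1 + ‖x‖) ^ l ≤ (1 + ‖x‖) ^ (k + l) := pow_le_pow_right₀ h1 (by omega)
  have a1 : C * (1 + ‖x‖) ^ k ≤ |C| * (1 + ‖x‖) ^ (k + l) :=
    mul_le_mul (le_abs_self C) hk (by positivity) (abs_nonneg _)
  have a2 : D * (1 + ‖x‖) ^ l ≤ |D| * (1 + ‖x‖) ^ (k + l) :=
    mul_le_mul (le_abs_self D) hl (by positivity) (abs_nonneg _)
  calc |f x + g x| ≤ |f x| + |g x| := abs_add_le _ _
    _ ≤ _ := by rw [add_mul]; linarith [hC x, hD x]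

theorem polyBounded_const (c : ℝ) : PolyBounded fun _ : Space N => c :=
  ⟨|c|, 0, fun x => by simp⟩

theorem polyBounded_evalAt (p : Poly N) : PolyBounded fun x : Space N => evalAt x p := by
  induction p using MvPolynomial.induction_on with
  | C a => simpa [evalAt] using polyBounded_const (N := N) a
  | add p q hp hq => simpa [evalAt] using hp.add hq
  | mul_X p j hp =>
    have hj : PolyBounded fun x : Space N => x j :=
      ⟨1, 1, fun x => by
        have := PiLp.norm_apply_le x j
        rw [Real.norm_eq_abs] at this
        linarith⟩
    simpa [evalAt] using hp.mul hj

theorem polyBounded_weight (Rp : Finset (Space N)) (κ : Space N → ℝ)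
    (hκ : ∀ v ∈ Rp, 0 ≤ κ v) : PolyBounded (weight Rp κ) := by
  classical
  unfold weight
  induction Rp using Finset.induction_on with
  | empty => simpa using polyBounded_const (N := N) 1
  | insert v s hv ih =>
    simp only [Finset.prod_insert hv]
    refine PolyBounded.mul ?_ (ih fun u hu => hκ u (Finset.mem_insert_of_mem hu))
    have h0 := hκ v (Finset.mem_insert_self v s)
    refine ⟨(1 + ‖v‖) ^ κ v, ⌈κ v⌉₊, fun x => ?_⟩
    have h1 : (1 : ℝ) ≤ 1 + ‖x‖ := by linarith [norm_nonneg x]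
    have hb : |inner ℝ x v| ≤ (1 + ‖v‖) * (1 + ‖x‖) := by
      nlinarith [abs_real_inner_le_norm x v, norm_nonneg x, norm_nonneg v]
    rw [abs_of_nonneg (Real.rpow_nonneg (abs_nonneg _) _)]
    calc |inner ℝ x v| ^ κ v ≤ ((1 + ‖v‖) * (1 + ‖x‖)) ^ κ v :=
          Real.rpow_le_rpow (abs_nonneg _) hb h0
      _ = (1 + ‖v‖) ^ κ v * (1 + ‖x‖) ^ κ v :=
          Real.mul_rpow (by positivity) (by positivity)
      _ ≤ (1 + ‖v‖) ^ κ v * (1 + ‖x‖) ^ ⌈κ v⌉₊ := by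
          gcongr
          rw [← Real.rpow_natCast]
          exact Real.rpow_le_rpow_of_exponent_le h1 (Nat.le_ceil _)

theorem integrable_of_polyBounded {f : Space N → ℝ} (hf : PolyBounded f) (hc : Continuous f)
    {ω : ℝ} (hω : 0 < ω) : Integrable fun x => f x * Real.exp (-ω * ‖x‖ ^ 2) := by
  obtain ⟨C, k, hC⟩ := hf
  obtain ⟨M, hM⟩ : ∃ M : ℝ, ∀ r : ℝ, 0 ≤ r →
      (1 + r) ^ (k + (N + 1)) * Real.exp (-ω * r ^ 2) ≤ M := by
    refine ⟨((k + (N + 1)).factorial : ℝ) * Real.exp (1 + 1 / (4 * ω)), fun r hr => ?_⟩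
    have h1 : (1 + r) ^ (k + (N + 1)) ≤
        ((k + (N + 1)).factorial : ℝ) * Real.exp (1 + r) := by
      have := Real.pow_div_factorial_le_exp (1 + r) (by linarith) (k + (N + 1))
      rw [div_le_iff₀ (by positivity)] at this
      linarith
    calc (1 + r) ^ (k + (N + 1)) * Real.exp (-ω * r ^ 2)
        ≤ ((k + (N + 1)).factorial : ℝ) * Real.exp (1 + r) * Real.exp (-ω * r ^ 2) := by gcongr
      _ = ((k + (N + 1)).factorial : ℝ) * Real.exp (1 + r + -ω * r ^ 2) := by
          rw [mul_assoc, ← Real.exp_add]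
      _ ≤ _ := by
          refine mul_le_mul_of_nonneg_left (Real.exp_le_exp.mpr ?_) (by positivity)
          have h2 : 1 / (4 * ω) - r + ω * r ^ 2 = ω * (r - 1 / (2 * ω)) ^ 2 := by
            field_simp
            ring
          have h3 : 0 ≤ ω * (r - 1 / (2 * ω)) ^ 2 := by positivity
          linarith
  have hint : Integrable fun x : Space N => (|C| * M) * (1 + ‖x‖) ^ (-((N : ℝ) + 1)) := by
    refine (integrable_one_add_norm ?_).const_mul _
    simp
  refine hint.mono' (by fun_prop) (Filter.Eventually.of_forall fun x => ?_)
  have h1 : (0 : ℝ) < 1 + ‖x‖ := by linarith [norm_nonneg x]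
  have hM' := hM ‖x‖ (norm_nonneg x)
  rw [Real.norm_eq_abs, abs_mul, Real.abs_exp, Real.rpow_neg h1.le]
  have h2 : (1 + ‖x‖) ^ ((N : ℝ) + 1) = (1 + ‖x‖) ^ (N + 1) := by
    rw [← Real.rpow_natCast]
    push_cast
    rfl
  rw [h2, ← div_eq_mul_inv, le_div_iff₀ (by positivity)]
  calc |f x| * Real.exp (-ω * ‖x‖ ^ 2) * (1 + ‖x‖) ^ (N + 1)
      ≤ (|C| * (1 + ‖x‖) ^ k) * Real.exp (-ω * ‖x‖ ^ 2) * (1 + ‖x‖) ^ (N + 1) := by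
        gcongr
        exact (hC x).trans (by gcongr; exact le_abs_self C)
    _ = |C| * ((1 + ‖x‖) ^ (k + (N + 1)) * Real.exp (-ω * ‖x‖ ^ 2)) := by
        rw [pow_add]; ring
    _ ≤ |C| * M := by gcongr

/-- The integrals in `integralForm` converge. -/
theorem integrable_gauss (Rp : Finset (Space N)) (κ : Space N → ℝ) (hκ : ∀ v ∈ Rp, 0 ≤ κ v)
    {ω : ℝ} (hω : 0 < ω) (p q : Poly N) :
    Integrable fun x : Space N =>
      evalAt x p * evalAt x q * Real.exp (-ω * ‖x‖ ^ 2) * weight Rp κ x ^ 2 := by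
  have hw := polyBounded_weight Rp κ hκ
  have hcw := continuous_weight Rp κ hκ
  have h := integrable_of_polyBounded
    (((polyBounded_evalAt p).mul (polyBounded_evalAt q)).mul (hw.mul hw))
    (((continuous_evalAt p).mul (continuous_evalAt q)).mul (hcw.mul hcw)) hω
  refine h.congr (Filter.Eventually.of_forall fun x => ?_)
  simp only
  ring

/-- The integral in `normConst` is positive. -/
theorem normIntegral_pos (R : Finset (Space N)) (u₀ : Space N) (κ : Space N → ℝ)
    (hκ : ∀ v ∈ R, 0 ≤ κ v) {ω : ℝ} (hω : 0 < ω) :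
    0 < ∫ x : Space N, Real.exp (-ω * ‖x‖ ^ 2) * weight (posRoots R u₀) κ x ^ 2 := by
  have hκ' : ∀ v ∈ posRoots R u₀, 0 ≤ κ v := fun v hv => hκ v (Finset.mem_filter.mp hv).1
  have hcw := continuous_weight (posRoots R u₀) κ hκ'
  have hint : Integrable fun x : Space N =>
      Real.exp (-ω * ‖x‖ ^ 2) * weight (posRoots R u₀) κ x ^ 2 := by
    simpa [evalAt] using integrable_gauss (posRoots R u₀) κ hκ' hω 1 1
  have hc : Continuous fun x : Space N =>
      Real.exp (-ω * ‖x‖ ^ 2) * weight (posRoots R u₀) κ x ^ 2 := by fun_prop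
  rw [integral_pos_iff_support_of_nonneg (fun x => by positivity) hint]
  refine hc.isOpen_support.measure_pos volume ⟨u₀, ?_⟩
  rw [Function.mem_support]
  have hw : 0 < weight (posRoots R u₀) κ u₀ := by
    unfold weight
    refine Finset.prod_pos fun v hv => Real.rpow_pos_of_pos (abs_pos.mpr ?_) _
    exact (Finset.mem_filter.mp hv).2.ne'
  positivity

end DunklOsc

end

namespace DunklOsc

variable {N : ℕ}

/-! ### Growth bounds -/

/-! Write `I p` for the integral of `p` against `exp(-ω|x|²) h_κ²`. Everything rests on two
properties, collected in `IsGaussian`: `I` is reflection-invariant, and `2ω x_i - D_i` is adjoint to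
`D_i` for `I (p q)`. The second is integration by parts (`gaussInt_dunkl_add`). As `h_κ²` need not
be differentiable on the mirrors when some `κ_v` is small, it is proved for the weight `∏ (⟨x, v⟩² +
ε)^{κ_v}`, and `ε → 0` by dominated convergence.

The rest is algebra. The Hamiltonian is symmetric for `I` (`IsGaussian.conjHamiltonian_symm`), which
settles `n ≠ k`. It is triangular for the degree filtration with the distinct diagonal entries `E_j`
(`conjHamiltonian_sub_mem_degLT`), so an eigenpolynomial for `E_n` has degree at most `n` and is
orthogonal to all polynomials of degree less than `n`.

For `n = k` only `π_n p` contributes to `I (p q)`. Moving a factor `x_i` from it onto `q` turns it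
into `D_i / (2ω)`; the correction has lower degree and vanishes by orthogonality. After `n` moves
`q` has become a constant, which sees only `π_n q`, and `I 1` cancels against the normalization.
Since the moves work in any order, commutativity of the Dunkl operators plays no role. -/

theorem PolyBounded.mono {f g : Space N → ℝ} (hg : PolyBounded g) (h : ∀ x, |f x| ≤ |g x|) :
    PolyBounded f := by
  obtain ⟨C, k, hC⟩ := hg
  exact ⟨C, k, fun x => (h x).trans (hC x)⟩

theorem PolyBounded.sum {ι : Type*} (s : Finset ι) {f : ι → Space N → ℝ}
    (h : ∀ i ∈ s, PolyBounded (f i)) : PolyBounded fun x => ∑ i ∈ s, f i x := by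
  classical
  induction s using Finset.induction_on with
  | empty => simpa using polyBounded_const (N := N) 0
  | insert a s ha ih =>
    simp only [Finset.sum_insert ha]
    exact (h a (Finset.mem_insert_self a s)).add
      (ih fun i hi => h i (Finset.mem_insert_of_mem hi))

theorem PolyBounded.prod {ι : Type*} (s : Finset ι) {f : ι → Space N → ℝ}
    (h : ∀ i ∈ s, PolyBounded (f i)) : PolyBounded fun x => ∏ i ∈ s, f i x := by
  classical
  induction s using Finset.induction_on with
  | empty => simpa using polyBounded_const (N := N) 1
  | insert a s ha ih =>
    simp only [Finset.prod_insert ha]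
    exact (h a (Finset.mem_insert_self a s)).mul
      (ih fun i hi => h i (Finset.mem_insert_of_mem hi))

theorem PolyBounded.rpow {f : Space N → ℝ} (hf : PolyBounded f) (h0 : ∀ x, 0 ≤ f x) {a : ℝ}
    (ha : 0 ≤ a) : PolyBounded fun x => f x ^ a := by
  obtain ⟨C, k, hC⟩ := hf
  refine ⟨|C| ^ a, ⌈k * a⌉₊, fun x => ?_⟩
  have h1 : (1 : ℝ) ≤ 1 + ‖x‖ := by linarith [norm_nonneg x]
  rw [abs_of_nonneg (Real.rpow_nonneg (h0 x) a)]
  have hb : f x ≤ |C| * (1 + ‖x‖) ^ k :=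
    ((le_abs_self _).trans (hC x)).trans (by gcongr; exact le_abs_self C)
  calc f x ^ a ≤ (|C| * (1 + ‖x‖) ^ k) ^ a := Real.rpow_le_rpow (h0 x) hb ha
    _ = |C| ^ a * (1 + ‖x‖) ^ (k * a) := by
        rw [Real.mul_rpow (abs_nonneg _) (by positivity), ← Real.rpow_natCast,
          ← Real.rpow_mul (by linarith)]
    _ ≤ |C| ^ a * (1 + ‖x‖) ^ ⌈k * a⌉₊ := by
        gcongr
        rw [← Real.rpow_natCast]
        exact Real.rpow_le_rpow_of_exponent_le h1 (Nat.le_ceil _)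

/-! ### The regularized weight -/

/-- The regularization `∏_{v ∈ R₊} (⟨x, v⟩² + ε)^{κ_v}` of `h_κ(x)²`. -/
noncomputable def regWeight (Rp : Finset (Space N)) (κ : Space N → ℝ) (ε : ℝ) (x : Space N) : ℝ :=
  ∏ v ∈ Rp, (inner ℝ x v ^ 2 + ε) ^ κ v

theorem weight_sq (Rp : Finset (Space N)) (κ : Space N → ℝ) (x : Space N) :
    weight Rp κ x ^ 2 = regWeight Rp κ 0 x := by
  unfold weight regWeight
  rw [← Finset.prod_pow]
  refine Finset.prod_congr rfl fun v _ => ?_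
  rw [add_zero, ← sq_abs (inner ℝ x v), ← Real.rpow_natCast, ← Real.rpow_natCast,
    ← Real.rpow_mul (abs_nonneg _), ← Real.rpow_mul (abs_nonneg _), mul_comm]

theorem regWeight_nonneg (Rp : Finset (Space N)) (κ : Space N → ℝ) {ε : ℝ} (hε : 0 ≤ ε)
    (x : Space N) : 0 ≤ regWeight Rp κ ε x :=
  Finset.prod_nonneg fun _ _ => Real.rpow_nonneg (by positivity) _

theorem continuous_regWeight (Rp : Finset (Space N)) (κ : Space N → ℝ) (hκ : ∀ v ∈ Rp, 0 ≤ κ v)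
    (ε : ℝ) : Continuous (regWeight Rp κ ε) := by
  unfold regWeight
  refine continuous_finsetProd _ fun v hv => ?_
  exact Continuous.rpow_const (by fun_prop) fun x => Or.inr (hκ v hv)

theorem continuous_regWeight_left (Rp : Finset (Space N)) (κ : Space N → ℝ)
    (hκ : ∀ v ∈ Rp, 0 ≤ κ v) (x : Space N) : Continuous fun ε => regWeight Rp κ ε x := by
  unfold regWeight
  refine continuous_finsetProd _ fun v hv => ?_
  exact Continuous.rpow_const (by fun_prop) fun x => Or.inr (hκ v hv)

theorem polyBounded_inner (v : Space N) : PolyBounded fun x : Space N => inner ℝ x v := by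
  simpa only [evalAt_linForm] using polyBounded_evalAt (linForm v)

theorem polyBounded_regWeight (Rp : Finset (Space N)) (κ : Space N → ℝ)
    (hκ : ∀ v ∈ Rp, 0 ≤ κ v) {ε : ℝ} (hε : 0 ≤ ε) : PolyBounded (regWeight Rp κ ε) := by
  refine PolyBounded.prod Rp fun v hv => PolyBounded.rpow ?_ (fun x => by positivity) (hκ v hv)
  simpa only [pow_two] using
    ((polyBounded_inner v).mul (polyBounded_inner v)).add (polyBounded_const ε)

/-- This lets the weight at `ε = 1` dominate all those with `0 < ε ≤ 1`. -/
theorem regWeight_mono (Rp : Finset (Space N)) (κ : Space N → ℝ) (hκ : ∀ v ∈ Rp, 0 ≤ κ v)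
    {ε η : ℝ} (hε : 0 ≤ ε) (h : ε ≤ η) (x : Space N) :
    regWeight Rp κ ε x ≤ regWeight Rp κ η x := by
  refine Finset.prod_le_prod (fun v _ => Real.rpow_nonneg (by positivity) _) fun v hv => ?_
  exact Real.rpow_le_rpow (by positivity) (by linarith) (hκ v hv)

theorem refl_refl (v x : Space N) : refl v (refl v x) = x :=
  Submodule.reflection_reflection _ x

theorem refl_self (v : Space N) : refl v v = -v :=
  Submodule.reflection_orthogonalComplement_singleton_eq_neg v

theorem inner_refl_left (u x v : Space N) :
    inner ℝ (refl u x) v = inner ℝ x (refl u v) := by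
  rw [← LinearIsometryEquiv.inner_map_map (refl u) x, refl_refl]

/-- A reflection permutes `R` but not `R₊`. The square of the weight is a product over all of `R`,
because `v` and `-v = σ_v v` give equal factors; that product is reindexed, and nonnegativity allows
taking the root. -/
theorem regWeight_refl {R : Finset (Space N)} (hR : IsRootSystem R) {u₀ : Space N}
    (hu₀ : ∀ v ∈ R, inner ℝ u₀ v ≠ 0) {κ : Space N → ℝ} (hκ : IsMultiplicity R κ) {ε : ℝ}
    (hε : 0 ≤ ε) {u : Space N} (hu : u ∈ R) (x : Space N) :
    regWeight (posRoots R u₀) κ ε (refl u x) = regWeight (posRoots R u₀) κ ε x := by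
  classical
  have hκr : ∀ v ∈ R, ∀ w ∈ R, κ (refl w v) = κ v := fun v hv w hw =>
    hκ v hv _ (Subgroup.subset_closure ⟨w, hw, rfl⟩)
  have hneg : ∀ v ∈ R, -v ∈ R := fun v hv => by
    simpa [refl_self] using hR.refl_mem v hv v hv
  have hsq : ∀ y, regWeight (posRoots R u₀) κ ε y ^ 2 =
      ∏ v ∈ R, (inner ℝ y v ^ 2 + ε) ^ κ v := by
    intro y
    have h2 : ∏ v ∈ R with ¬ 0 < inner ℝ u₀ v, (inner ℝ y v ^ 2 + ε) ^ κ v =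
        regWeight (posRoots R u₀) κ ε y := by
      refine Finset.prod_bij' (fun v _ => -v) (fun v _ => -v) ?_ ?_ ?_ ?_ ?_
      · intro v hv
        obtain ⟨h1, h2⟩ := Finset.mem_filter.mp hv
        have := hu₀ v h1
        refine Finset.mem_filter.mpr ⟨hneg v h1, ?_⟩
        rw [inner_neg_right]
        rcases lt_trichotomy (inner ℝ u₀ v) 0 with h | h | h
        · linarith
        · exact absurd h this
        · exact absurd h h2
      · intro v hv
        obtain ⟨h1, h2⟩ := Finset.mem_filter.mp hv
        refine Finset.mem_filter.mpr ⟨hneg v h1, ?_⟩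
        rw [inner_neg_right]
        linarith
      · simp
      · simp
      · intro v hv
        have h1 := (Finset.mem_filter.mp hv).1
        rw [inner_neg_right, neg_sq, ← hκr v h1 v h1, refl_self]
    rw [← Finset.prod_filter_mul_prod_filter_not R (fun v => 0 < inner ℝ u₀ v), h2, sq]
    congr 1
  have key : ∏ v ∈ R, (inner ℝ (refl u x) v ^ 2 + ε) ^ κ v =
      ∏ v ∈ R, (inner ℝ x v ^ 2 + ε) ^ κ v := by
    refine Finset.prod_bij' (fun v _ => refl u v) (fun v _ => refl u v)
      (fun v hv => hR.refl_mem v hv u hu) (fun v hv => hR.refl_mem v hv u hu)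
      (fun v _ => refl_refl u v) (fun v _ => refl_refl u v) fun v hv => ?_
    rw [inner_refl_left, hκr v hv u hu]
  rw [← sq_eq_sq₀ (regWeight_nonneg _ _ hε _) (regWeight_nonneg _ _ hε _), hsq, hsq, key]

/-! ### Derivatives in coordinate directions -/

theorem HasLineDerivAt.mul {E : Type*} [AddCommGroup E] [Module ℝ E] {f g : E → ℝ} {f' g' : ℝ}
    {x v : E} (hf : HasLineDerivAt ℝ f f' x v) (hg : HasLineDerivAt ℝ g g' x v) :
    HasLineDerivAt ℝ (fun y => f y * g y) (f' * g x + f x * g') x v := by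
  have h := HasDerivAt.fun_mul hf hg
  simp only [zero_smul, add_zero] at h
  exact h

theorem hasLineDerivAt_const {E : Type*} [AddCommGroup E] [Module ℝ E] (c : ℝ) (x v : E) :
    HasLineDerivAt ℝ (fun _ : E => c) 0 x v :=
  hasDerivAt_const (0 : ℝ) c

theorem hasLineDerivAt_coord (i j : Fin N) (x : Space N) :
    HasLineDerivAt ℝ (fun y : Space N => y j) (if j = i then 1 else 0) x
      (EuclideanSpace.single i 1) := by
  have h : HasDerivAt (fun t : ℝ => x j + t * (if j = i then 1 else 0))
      (if j = i then 1 else 0) 0 := by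
    simpa using ((hasDerivAt_id (0 : ℝ)).mul_const (if j = i then 1 else 0)).const_add (x j)
  have e : (fun t : ℝ => (x + t • EuclideanSpace.single i (1 : ℝ)) j) =
      fun t => x j + t * (if j = i then 1 else 0) := by
    ext t
    simp
  unfold HasLineDerivAt
  rw [e]
  exact h

theorem hasLineDerivAt_evalAt (i : Fin N) (p : Poly N) (x : Space N) :
    HasLineDerivAt ℝ (fun y => evalAt y p) (evalAt x (MvPolynomial.pderiv i p)) x
      (EuclideanSpace.single i 1) := by
  induction p using MvPolynomial.induction_on with
  | C a => simpa [evalAt] using hasLineDerivAt_const a x (EuclideanSpace.single i 1)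
  | add p q hp hq =>
    have h := HasDerivAt.fun_add hp hq
    simp only [evalAt, map_add] at h ⊢
    exact h
  | mul_X p j hp =>
    have h := HasLineDerivAt.mul hp (hasLineDerivAt_coord i j x)
    simp only [evalAt, MvPolynomial.pderiv_mul, map_add, map_mul, MvPolynomial.eval_X,
      MvPolynomial.pderiv_X] at h ⊢
    convert h using 3
    simp [Pi.single_apply]

theorem hasLineDerivAt_inner (i : Fin N) (v x : Space N) :
    HasLineDerivAt ℝ (fun y : Space N => inner ℝ y v) (v i) x (EuclideanSpace.single i 1) := by
  have h := hasLineDerivAt_evalAt i (linForm v) x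
  simp only [evalAt_linForm] at h
  have e : evalAt x (MvPolynomial.pderiv i (linForm v)) = v i := by
    simp [linForm, evalAt, MvPolynomial.pderiv_X, Pi.single_apply, apply_ite]
  rwa [e] at h

theorem hasLineDerivAt_gauss (ω : ℝ) (i : Fin N) (x : Space N) :
    HasLineDerivAt ℝ (fun y : Space N => Real.exp (-ω * ‖y‖ ^ 2))
      (-(2 * ω * x i) * Real.exp (-ω * ‖x‖ ^ 2)) x (EuclideanSpace.single i 1) := by
  have h1 : HasDerivAt (fun t : ℝ => ‖x‖ ^ 2 + 2 * (t * x i) + t ^ 2) (2 * x i) 0 := by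
    have := (((((hasDerivAt_id' (0 : ℝ)).mul_const (x i)).const_mul 2).const_add
      (‖x‖ ^ 2))).fun_add ((hasDerivAt_id' (0 : ℝ)).fun_pow 2)
    exact this.congr_deriv (by simp)
  have h := (h1.const_mul (-ω)).exp
  have e : (fun t : ℝ => Real.exp (-ω * ‖x + t • EuclideanSpace.single i (1 : ℝ)‖ ^ 2)) =
      fun t => Real.exp (-ω * (‖x‖ ^ 2 + 2 * (t * x i) + t ^ 2)) := by
    ext t
    rw [norm_add_sq_real, inner_smul_right, EuclideanSpace.inner_single_right, norm_smul]
    simp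
  unfold HasLineDerivAt
  rw [e]
  refine h.congr_deriv ?_
  simp
  ring

/-- Logarithmic differentiation. With `ε > 0` each base is positive, so the real powers are
differentiable on the mirrors too, even for `κ_v < 1`. -/
theorem hasLineDerivAt_regWeight (Rp : Finset (Space N)) (κ : Space N → ℝ) {ε : ℝ} (hε : 0 < ε)
    (i : Fin N) (x : Space N) :
    HasLineDerivAt ℝ (regWeight Rp κ ε)
      (regWeight Rp κ ε x *
        ∑ v ∈ Rp, κ v * v i * (2 * (inner ℝ x v / (inner ℝ x v ^ 2 + ε)))) x
      (EuclideanSpace.single i 1) := by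
  classical
  unfold regWeight
  induction Rp using Finset.induction_on with
  | empty => simpa using hasLineDerivAt_const 1 x (EuclideanSpace.single i 1)
  | insert v s hv ih =>
    simp only [Finset.prod_insert hv, Finset.sum_insert hv]
    have h0 : 0 < inner ℝ x v ^ 2 + ε := by positivity
    have h1 : HasLineDerivAt ℝ (fun y : Space N => (inner ℝ y v ^ 2 + ε) ^ κ v)
        ((2 * inner ℝ x v * v i) * κ v * (inner ℝ x v ^ 2 + ε) ^ (κ v - 1)) x
        (EuclideanSpace.single i 1) := by
      have h2 := ((HasDerivAt.fun_pow (hasLineDerivAt_inner i v x) 2).add_const ε).rpow_const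
        (p := κ v) (Or.inl (by simpa using h0.ne'))
      exact h2.congr_deriv (by simp)
    refine HasDerivAt.congr_deriv (HasLineDerivAt.mul h1 ih) ?_
    rw [Real.rpow_sub_one h0.ne']
    field_simp

/-! ### The Gaussian functional -/

theorem evalAt_add (x : Space N) (p q : Poly N) : evalAt x (p + q) = evalAt x p + evalAt x q :=
  map_add _ _ _

theorem evalAt_sub (x : Space N) (p q : Poly N) : evalAt x (p - q) = evalAt x p - evalAt x q :=
  map_sub _ _ _

theorem evalAt_mul (x : Space N) (p q : Poly N) : evalAt x (p * q) = evalAt x p * evalAt x q :=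
  map_mul _ _ _

theorem evalAt_smul (x : Space N) (c : ℝ) (p : Poly N) : evalAt x (c • p) = c * evalAt x p :=
  MvPolynomial.smul_eval _ _ _

theorem evalAt_X (x : Space N) (i : Fin N) : evalAt x (MvPolynomial.X i) = x i :=
  MvPolynomial.eval_X i

/-- The linear functional `p ↦ ∫ p(x) exp(-ω |x|²) h_κ(x)² dx`. -/
noncomputable def gaussInt (Rp : Finset (Space N)) (κ : Space N → ℝ) (hκ : ∀ v ∈ Rp, 0 ≤ κ v)
    {ω : ℝ} (hω : 0 < ω) : Poly N →ₗ[ℝ] ℝ where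
  toFun p := ∫ x : Space N, evalAt x p * Real.exp (-ω * ‖x‖ ^ 2) * regWeight Rp κ 0 x
  map_add' p q := by
    have hi : ∀ p : Poly N, Integrable fun x : Space N =>
        evalAt x p * Real.exp (-ω * ‖x‖ ^ 2) * regWeight Rp κ 0 x := fun p => by
      simpa [weight_sq, evalAt] using integrable_gauss Rp κ hκ hω p 1
    rw [← integral_add (hi p) (hi q)]
    refine integral_congr_ae (Filter.Eventually.of_forall fun x => ?_)
    simp only [evalAt_add]
    ring
  map_smul' c p := by
    rw [RingHom.id_apply, smul_eq_mul, ← integral_const_mul]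
    refine integral_congr_ae (Filter.Eventually.of_forall fun x => ?_)
    simp only [evalAt_smul]
    ring

theorem integralForm_eq_gaussInt (Rp : Finset (Space N)) (κ : Space N → ℝ)
    (hκ : ∀ v ∈ Rp, 0 ≤ κ v) {ω : ℝ} (hω : 0 < ω) (p q : Poly N) :
    integralForm Rp κ ω p q = normConst Rp κ ω * gaussInt Rp κ hκ hω (p * q) := by
  simp only [integralForm, gaussInt, weight_sq, LinearMap.coe_mk, AddHom.coe_mk, evalAt_mul]

theorem normConst_mul_gaussInt_one (R : Finset (Space N)) (u₀ : Space N) (κ : Space N → ℝ)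
    (hκ : ∀ v ∈ R, 0 ≤ κ v) (hκ' : ∀ v ∈ posRoots R u₀, 0 ≤ κ v) {ω : ℝ} (hω : 0 < ω) :
    normConst (posRoots R u₀) κ ω * gaussInt (posRoots R u₀) κ hκ' hω 1 = 1 := by
  have h : gaussInt (posRoots R u₀) κ hκ' hω 1 =
      ∫ x : Space N, Real.exp (-ω * ‖x‖ ^ 2) * weight (posRoots R u₀) κ x ^ 2 := by
    simp [gaussInt, weight_sq, evalAt]
  rw [h, normConst]
  exact inv_mul_cancel₀ (normIntegral_pos R u₀ κ hκ hω).ne'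

theorem norm_refl (u x : Space N) : ‖refl u x‖ = ‖x‖ := (refl u).norm_map x

theorem integral_comp_refl (u : Space N) (f : Space N → ℝ) :
    ∫ x, f (refl u x) = ∫ x, f x :=
  (refl u).measurePreserving.integral_comp (refl u).toHomeomorph.measurableEmbedding f

theorem gaussInt_reflPoly {R : Finset (Space N)} (hR : IsRootSystem R) {u₀ : Space N}
    (hu₀ : ∀ v ∈ R, inner ℝ u₀ v ≠ 0) {κ : Space N → ℝ} (hκ : IsMultiplicity R κ)
    (hκ' : ∀ v ∈ posRoots R u₀, 0 ≤ κ v) {ω : ℝ} (hω : 0 < ω) {u : Space N} (hu : u ∈ R)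
    (p : Poly N) :
    gaussInt (posRoots R u₀) κ hκ' hω (reflPoly u p) = gaussInt (posRoots R u₀) κ hκ' hω p := by
  simp only [gaussInt, LinearMap.coe_mk, AddHom.coe_mk]
  rw [← integral_comp_refl u]
  refine integral_congr_ae (Filter.Eventually.of_forall fun x => ?_)
  simp only
  rw [evalAt_reflPoly, refl_refl, norm_refl, regWeight_refl hR hu₀ hκ le_rfl hu]

/-! ### Integration by parts -/

/-- Integration by parts against the constant `1`; integrability of `f` and `f'` replaces the
discussion of boundary terms. -/
theorem integral_eq_zero_of_hasLineDerivAt {f f' : Space N → ℝ} {v : Space N}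
    (hf : ∀ x, HasLineDerivAt ℝ f (f' x) x v) (hi : Integrable f) (hi' : Integrable f') :
    ∫ x, f' x = 0 := by
  have h := integral_bilinear_hasLineDerivAt_right_eq_neg_left_of_integrable (μ := volume)
    (f := f) (f' := f') (g := fun _ => (1 : ℝ)) (g' := fun _ => 0) (v := v)
    (B := ContinuousLinearMap.mul ℝ ℝ) (by simpa using hi') (by simp) (by simpa using hi)
    (fun x _ => hf x) (fun x _ => hasLineDerivAt_const 1 x v)
  simpa using h

/-- The bound degenerates as `ε → 0`; it only serves integrability at fixed `ε`. -/
theorem abs_div_sq_add_le (t : ℝ) {ε : ℝ} (hε : 0 < ε) : |t / (t ^ 2 + ε)| ≤ |t * ε⁻¹| := by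
  rw [abs_div, abs_mul, div_eq_mul_inv]
  gcongr
  rw [abs_inv, abs_of_pos hε, abs_of_pos (by positivity)]
  exact inv_anti₀ hε (by linarith [sq_nonneg t])

theorem polyBounded_inner_div (v : Space N) {ε : ℝ} (hε : 0 < ε) :
    PolyBounded fun x : Space N => inner ℝ x v / (inner ℝ x v ^ 2 + ε) :=
  ((polyBounded_inner v).mul (polyBounded_const ε⁻¹)).mono fun _ => abs_div_sq_add_le _ hε

theorem continuous_inner_div (v : Space N) {ε : ℝ} (hε : 0 < ε) :
    Continuous fun x : Space N => inner ℝ x v / (inner ℝ x v ^ 2 + ε) :=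
  Continuous.div (by fun_prop) (by fun_prop) fun x => by positivity

theorem integrable_regWeight (Rp : Finset (Space N)) (κ : Space N → ℝ) (hκ : ∀ v ∈ Rp, 0 ≤ κ v)
    {ω : ℝ} (hω : 0 < ω) {ε : ℝ} (hε : 0 ≤ ε) {f : Space N → ℝ} (hf : PolyBounded f)
    (hc : Continuous f) :
    Integrable fun x => f x * Real.exp (-ω * ‖x‖ ^ 2) * regWeight Rp κ ε x := by
  refine (integrable_of_polyBounded (hf.mul (polyBounded_regWeight Rp κ hκ hε))
    (hc.mul (continuous_regWeight Rp κ hκ ε)) hω).congr (Filter.Eventually.of_forall fun x => ?_)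
  simp only
  ring

/-- The integrand is the `i`-th partial derivative of `p(x) exp(-ω|x|²)` times the regularized
weight. -/
theorem integral_pderiv_regWeight (Rp : Finset (Space N)) (κ : Space N → ℝ)
    (hκ : ∀ v ∈ Rp, 0 ≤ κ v) {ω : ℝ} (hω : 0 < ω) {ε : ℝ} (hε : 0 < ε) (i : Fin N) (p : Poly N) :
    ∫ x : Space N, (evalAt x (MvPolynomial.pderiv i p - (2 * ω) • (MvPolynomial.X i * p)) +
        ∑ v ∈ Rp, κ v * v i * (2 * (inner ℝ x v / (inner ℝ x v ^ 2 + ε))) * evalAt x p) *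
      Real.exp (-ω * ‖x‖ ^ 2) * regWeight Rp κ ε x = 0 := by
  refine integral_eq_zero_of_hasLineDerivAt (v := EuclideanSpace.single i 1)
    (f := fun x => evalAt x p * Real.exp (-ω * ‖x‖ ^ 2) * regWeight Rp κ ε x)
    (fun x => ?_) ?_ ?_
  · refine HasDerivAt.congr_deriv (HasLineDerivAt.mul (HasLineDerivAt.mul
      (hasLineDerivAt_evalAt i p x) (hasLineDerivAt_gauss ω i x))
      (hasLineDerivAt_regWeight Rp κ hε i x)) ?_
    rw [evalAt_sub, evalAt_smul, evalAt_mul, evalAt_X, ← Finset.sum_mul]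
    ring
  · exact integrable_regWeight Rp κ hκ hω hε.le (polyBounded_evalAt p) (continuous_evalAt p)
  · refine integrable_regWeight Rp κ hκ hω hε.le ((polyBounded_evalAt _).add
      (PolyBounded.sum _ fun v _ => ((polyBounded_const _).mul ((polyBounded_const _).mul
        (polyBounded_inner_div v hε))).mul (polyBounded_evalAt p)))
      ((continuous_evalAt _).add (continuous_finsetSum _ fun v _ => (continuous_const.mul
        (continuous_const.mul (continuous_inner_div v hε))).mul (continuous_evalAt p)))

theorem mem_of_mem_posRoots {R : Finset (Space N)} {u₀ v : Space N} (hv : v ∈ posRoots R u₀) :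
    v ∈ R := by
  unfold posRoots at hv
  exact (Finset.mem_filter.mp hv).1

/-- The change of variables by `σ_v` flips the sign of `⟨x, v⟩` and fixes every other factor, so the
integral equals its own negative. -/
theorem integral_odd_regWeight {R : Finset (Space N)} (hR : IsRootSystem R) {u₀ : Space N}
    (hu₀ : ∀ v ∈ R, inner ℝ u₀ v ≠ 0) {κ : Space N → ℝ} (hκ : IsMultiplicity R κ) (ω : ℝ)
    {ε : ℝ} (hε : 0 ≤ ε) {v : Space N} (hv : v ∈ R) (p : Poly N) (hp : reflPoly v p = p) :
    ∫ x : Space N, inner ℝ x v / (inner ℝ x v ^ 2 + ε) * evalAt x p *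
      Real.exp (-ω * ‖x‖ ^ 2) * regWeight (posRoots R u₀) κ ε x = 0 := by
  have h := integral_comp_refl v fun x => inner ℝ x v / (inner ℝ x v ^ 2 + ε) * evalAt x p *
      Real.exp (-ω * ‖x‖ ^ 2) * regWeight (posRoots R u₀) κ ε x
  simp only [norm_refl, regWeight_refl hR hu₀ hκ hε hv, ← evalAt_reflPoly, hp, inner_refl_left,
    refl_self, inner_neg_right, neg_sq, neg_div, neg_mul, integral_neg] at h ⊢
  linarith

theorem reflPoly_reflPoly (v : Space N) (p : Poly N) : reflPoly v (reflPoly v p) = p := by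
  refine MvPolynomial.funext fun y => ?_
  have h := evalAt_reflPoly v (WithLp.toLp 2 y) (reflPoly v p)
  exact h.trans (by rw [evalAt_reflPoly, refl_refl]; rfl)

/-- The polarization `q ∂_v p + p ∂_v q` of the difference operator, for which
`⟨x, v⟩ · polarDiff v p q = 2 p q - (σ_v p) q - p (σ_v q)`. -/
noncomputable def polarDiff (v : Space N) (p q : Poly N) : Poly N :=
  divDiff v p * q + p * divDiff v q

theorem linForm_mul_polarDiff (v : Space N) (p q : Poly N) :
    linForm v * polarDiff v p q = 2 * (p * q) - (reflPoly v p * q + p * reflPoly v q) := by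
  unfold polarDiff
  linear_combination q * linForm_mul_divDiff v p + p * linForm_mul_divDiff v q

/-- In the logarithmic derivative, `2 p q` is replaced by `⟨x, v⟩ · polarDiff v p q`: the difference
`(σ_v p) q + p (σ_v q)` is `σ_v`-invariant and contributes nothing by oddness. The singular factor
`⟨x, v⟩ / (⟨x, v⟩² + ε)` thereby becomes `⟨x, v⟩² / (⟨x, v⟩² + ε)`, which is at most `1` uniformly
in `ε`. -/
theorem integral_dunkl_regWeight {R : Finset (Space N)} (hR : IsRootSystem R) {u₀ : Space N}
    (hu₀ : ∀ v ∈ R, inner ℝ u₀ v ≠ 0) {κ : Space N → ℝ} (hκ : IsMultiplicity R κ)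
    (hκ' : ∀ v ∈ posRoots R u₀, 0 ≤ κ v) {ω : ℝ} (hω : 0 < ω) {ε : ℝ} (hε : 0 < ε) (i : Fin N)
    (p q : Poly N) :
    ∫ x : Space N, (evalAt x (MvPolynomial.pderiv i (p * q) -
          (2 * ω) • (MvPolynomial.X i * (p * q))) +
        ∑ v ∈ posRoots R u₀, κ v * v i * (inner ℝ x v ^ 2 / (inner ℝ x v ^ 2 + ε)) *
          evalAt x (polarDiff v p q)) *
      Real.exp (-ω * ‖x‖ ^ 2) * regWeight (posRoots R u₀) κ ε x = 0 := by
  set Rp := posRoots R u₀ with hRp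
  have h1 := integral_pderiv_regWeight Rp κ hκ' hω hε i (p * q)
  have hodd : ∀ v ∈ Rp, ∫ x : Space N, inner ℝ x v / (inner ℝ x v ^ 2 + ε) *
      evalAt x (reflPoly v p * q + p * reflPoly v q) *
      Real.exp (-ω * ‖x‖ ^ 2) * regWeight Rp κ ε x = 0 := fun v hv =>
    integral_odd_regWeight hR hu₀ hκ ω hε.le (mem_of_mem_posRoots hv) _ (by
      rw [map_add, map_mul, map_mul, reflPoly_reflPoly, reflPoly_reflPoly]; ring)
  have hint : ∀ v ∈ Rp, Integrable fun x : Space N => κ v * v i *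
      (inner ℝ x v / (inner ℝ x v ^ 2 + ε) *
      evalAt x (reflPoly v p * q + p * reflPoly v q) *
      Real.exp (-ω * ‖x‖ ^ 2) * regWeight Rp κ ε x) := fun v _ =>
    (integrable_regWeight Rp κ hκ' hω hε.le
      ((polyBounded_inner_div v hε).mul (polyBounded_evalAt _))
      ((continuous_inner_div v hε).mul (continuous_evalAt _))).const_mul _
  have h2 : ∫ x : Space N, ∑ v ∈ Rp, κ v * v i * (inner ℝ x v / (inner ℝ x v ^ 2 + ε) *
      evalAt x (reflPoly v p * q + p * reflPoly v q) *
      Real.exp (-ω * ‖x‖ ^ 2) * regWeight Rp κ ε x) = 0 := by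
    rw [integral_finsetSum _ hint]
    refine Finset.sum_eq_zero fun v hv => ?_
    rw [integral_const_mul, hodd v hv, mul_zero]
  have hI := integrable_regWeight Rp κ hκ' hω hε.le ((polyBounded_evalAt
      (MvPolynomial.pderiv i (p * q) - (2 * ω) • (MvPolynomial.X i * (p * q)))).add
      (PolyBounded.sum Rp fun v _ => ((polyBounded_const (κ v * v i)).mul ((polyBounded_const 2).mul
        (polyBounded_inner_div v hε))).mul (polyBounded_evalAt (p * q))))
      ((continuous_evalAt _).add (continuous_finsetSum _ fun v _ => (continuous_const.mul
        (continuous_const.mul (continuous_inner_div v hε))).mul (continuous_evalAt (p * q))))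
  have h3 := integral_sub hI (integrable_finsetSum Rp hint)
  rw [h1, h2, sub_zero] at h3
  rw [← h3]
  refine integral_congr_ae (Filter.Eventually.of_forall fun x => ?_)
  simp only
  rw [add_mul, add_mul, add_mul, add_mul, Finset.sum_mul, Finset.sum_mul,
    Finset.sum_mul, Finset.sum_mul, add_sub_assoc, ← Finset.sum_sub_distrib]
  congr 1
  refine Finset.sum_congr rfl fun v _ => ?_
  have h4 := congrArg (evalAt x) (linForm_mul_polarDiff v p q)
  rw [evalAt_mul, evalAt_linForm, evalAt_sub, evalAt_mul x 2] at h4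
  have h5 : evalAt x (2 : Poly N) = 2 := map_ofNat _ 2
  rw [h5] at h4
  linear_combination (κ v * v i * (inner ℝ x v / (inner ℝ x v ^ 2 + ε)) *
    Real.exp (-ω * ‖x‖ ^ 2) * regWeight Rp κ ε x) * h4

theorem ae_inner_ne_zero {v : Space N} (hv : v ≠ 0) : ∀ᵐ x : Space N, inner ℝ x v ≠ 0 := by
  have h := Measure.addHaar_submodule (volume : Measure (Space N)) (Submodule.span ℝ {v})ᗮ (by
    intro h
    have hm : v ∈ (Submodule.span ℝ {v})ᗮ := h ▸ Submodule.mem_top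
    exact hv (inner_self_eq_zero.mp (Submodule.mem_orthogonal_singleton_iff_inner_left.mp hm)))
  rw [ae_iff]
  convert h using 2
  ext x
  simp [Submodule.mem_orthogonal_singleton_iff_inner_left]

/-- The limit of `integral_dunkl_regWeight` along `ε = 1 / (n + 1)`. The quotients lie in `[0, 1]`
and tend to `1` off the mirrors, which are null sets. -/
theorem gaussInt_pderiv {R : Finset (Space N)} (hR : IsRootSystem R) {u₀ : Space N}
    (hu₀ : ∀ v ∈ R, inner ℝ u₀ v ≠ 0) {κ : Space N → ℝ} (hκ : IsMultiplicity R κ)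
    (hκ' : ∀ v ∈ posRoots R u₀, 0 ≤ κ v) {ω : ℝ} (hω : 0 < ω) (i : Fin N) (p q : Poly N) :
    gaussInt (posRoots R u₀) κ hκ' hω (MvPolynomial.pderiv i (p * q) -
      (2 * ω) • (MvPolynomial.X i * (p * q)) +
        ∑ v ∈ posRoots R u₀, (κ v * v i) • polarDiff v p q) = 0 := by
  set Rp := posRoots R u₀ with hRp
  set A := MvPolynomial.pderiv i (p * q) - (2 * ω) • (MvPolynomial.X i * (p * q)) with hA
  have hpos : ∀ n : ℕ, (0 : ℝ) < 1 / ((n : ℝ) + 1) := fun n => Nat.one_div_pos_of_nat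
  have hle : ∀ n : ℕ, 1 / ((n : ℝ) + 1) ≤ 1 := fun n => by
    rw [div_le_one (by positivity)]
    linarith [Nat.cast_nonneg (α := ℝ) n]
  have hlim := tendsto_one_div_add_atTop_nhds_zero_nat (𝕜 := ℝ)
  have key := tendsto_integral_of_dominated_convergence (μ := (volume : Measure (Space N)))
    (F := fun (n : ℕ) x => (evalAt x A + ∑ v ∈ Rp, κ v * v i *
      (inner ℝ x v ^ 2 / (inner ℝ x v ^ 2 + 1 / ((n : ℝ) + 1))) * evalAt x (polarDiff v p q)) *
      Real.exp (-ω * ‖x‖ ^ 2) * regWeight Rp κ (1 / ((n : ℝ) + 1)) x)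
    (f := fun x => (evalAt x A + ∑ v ∈ Rp, κ v * v i * 1 * evalAt x (polarDiff v p q)) *
      Real.exp (-ω * ‖x‖ ^ 2) * regWeight Rp κ 0 x)
    (fun x => (|evalAt x A| + ∑ v ∈ Rp, |κ v * v i| * |evalAt x (polarDiff v p q)|) *
      Real.exp (-ω * ‖x‖ ^ 2) * regWeight Rp κ 1 x) ?_ ?_ ?_ ?_
  · simp only [hA, hRp, integral_dunkl_regWeight hR hu₀ hκ hκ' hω (hpos _) i p q] at key
    have h := tendsto_nhds_unique key tendsto_const_nhds
    rw [← h]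
    simp only [gaussInt, LinearMap.coe_mk, AddHom.coe_mk]
    refine integral_congr_ae (Filter.Eventually.of_forall fun x => ?_)
    have hs : evalAt x (∑ v ∈ Rp, (κ v * v i) • polarDiff v p q) =
        ∑ v ∈ Rp, κ v * v i * 1 * evalAt x (polarDiff v p q) := by
      unfold evalAt
      rw [map_sum]
      exact Finset.sum_congr rfl fun v _ => by rw [MvPolynomial.smul_eval, mul_one]
    simp only [← hRp, ← hA] at hs ⊢
    rw [evalAt_add, hs]
  · intro n
    refine Continuous.aestronglyMeasurable ?_
    refine Continuous.mul (Continuous.mul ((continuous_evalAt A).add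
      (continuous_finsetSum _ fun v _ => (continuous_const.mul ?_).mul (continuous_evalAt _)))
      (by fun_prop)) (continuous_regWeight Rp κ hκ' _)
    have := hpos n
    exact Continuous.div (by fun_prop) (by fun_prop) fun x => by positivity
  · refine integrable_regWeight Rp κ hκ' hω zero_le_one ?_ ?_
    · exact ((polyBounded_evalAt A).mono fun x => by rw [abs_abs]).add (PolyBounded.sum _ fun v _ =>
        (polyBounded_const _).mul ((polyBounded_evalAt (polarDiff v p q)).mono
          fun x => by rw [abs_abs]))
    · exact (continuous_evalAt A).abs.add (continuous_finsetSum _ fun v _ =>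
        continuous_const.mul (continuous_evalAt _).abs)
  · refine fun n => Filter.Eventually.of_forall fun x => ?_
    have hn := hpos n
    rw [Real.norm_eq_abs, abs_mul, abs_mul, Real.abs_exp,
      abs_of_nonneg (regWeight_nonneg Rp κ hn.le x)]
    have hw := regWeight_mono Rp κ hκ' hn.le (hle n) x
    have hb : |evalAt x A + ∑ v ∈ Rp, κ v * v i *
        (inner ℝ x v ^ 2 / (inner ℝ x v ^ 2 + 1 / ((n : ℝ) + 1))) * evalAt x (polarDiff v p q)| ≤
        |evalAt x A| + ∑ v ∈ Rp, |κ v * v i| * |evalAt x (polarDiff v p q)| := by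
      refine (abs_add_le _ _).trans (add_le_add le_rfl ((Finset.abs_sum_le_sum_abs _ _).trans
        (Finset.sum_le_sum fun v _ => ?_)))
      rw [abs_mul, abs_mul]
      refine mul_le_mul_of_nonneg_right (mul_le_of_le_one_right (abs_nonneg _) ?_) (abs_nonneg _)
      rw [abs_of_nonneg (by positivity)]
      exact div_le_one_of_le₀ (by linarith) (by positivity)
    have h0 := regWeight_nonneg Rp κ hn.le x
    gcongr
  · have hae : ∀ᵐ x : Space N, ∀ v ∈ Rp, inner ℝ x v ≠ 0 := by
      refine (ae_ball_iff (S := (Rp : Set (Space N))) Rp.countable_toSet).mpr ?_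
      exact fun v hv => ae_inner_ne_zero (hR.ne_zero v (mem_of_mem_posRoots hv))
    filter_upwards [hae] with x hx
    refine Filter.Tendsto.mul (Filter.Tendsto.mul (tendsto_const_nhds.add
      (tendsto_finsetSum _ fun v hv => (tendsto_const_nhds.mul ?_).mul tendsto_const_nhds))
      tendsto_const_nhds) (((continuous_regWeight_left Rp κ hκ' x).tendsto 0).comp hlim)
    have h0 : inner ℝ x v ^ 2 ≠ 0 := pow_ne_zero 2 (hx v hv)
    have h := (tendsto_const_nhds (x := inner ℝ x v ^ 2)).div
      ((tendsto_const_nhds (x := inner ℝ x v ^ 2)).add hlim) (by simpa using h0)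
    rwa [add_zero, div_self h0] at h

theorem dunkl_apply (Rp : Finset (Space N)) (κ : Space N → ℝ) (i : Fin N) (p : Poly N) :
    dunkl Rp κ i p = MvPolynomial.pderiv i p + ∑ v ∈ Rp, (κ v * v i) • divDiff v p := by
  simp [dunkl, LinearMap.sum_apply]

/-- The adjoint of `D_i` for the Gaussian form is `2ω x_i - D_i`. -/
theorem gaussInt_dunkl_add {R : Finset (Space N)} (hR : IsRootSystem R) {u₀ : Space N}
    (hu₀ : ∀ v ∈ R, inner ℝ u₀ v ≠ 0) {κ : Space N → ℝ} (hκ : IsMultiplicity R κ)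
    (hκ' : ∀ v ∈ posRoots R u₀, 0 ≤ κ v) {ω : ℝ} (hω : 0 < ω) (i : Fin N) (p q : Poly N) :
    gaussInt (posRoots R u₀) κ hκ' hω (dunkl (posRoots R u₀) κ i p * q) +
      gaussInt (posRoots R u₀) κ hκ' hω (p * dunkl (posRoots R u₀) κ i q) =
      2 * ω * gaussInt (posRoots R u₀) κ hκ' hω (MvPolynomial.X i * (p * q)) := by
  have h := gaussInt_pderiv hR hu₀ hκ hκ' hω i p q
  rw [← map_add, ← smul_eq_mul (2 * ω), ← map_smul, ← sub_eq_zero, ← map_sub, ← h]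
  congr 1
  simp only [dunkl_apply, polarDiff, smul_add, Finset.sum_add_distrib, MvPolynomial.pderiv_mul, add_mul,
    mul_add, Finset.sum_mul, Finset.mul_sum, smul_mul_assoc, mul_smul_comm]
  ring

/-! ### The degree filtration -/

/-- The polynomials all of whose monomials have degree less than `j`. -/
def degLT (j : ℕ) : Submodule ℝ (Poly N) where
  carrier := {p | ∀ m : Fin N →₀ ℕ, j ≤ m.degree → p.coeff m = 0}
  add_mem' hp hq m hm := by rw [MvPolynomial.coeff_add, hp m hm, hq m hm, add_zero]
  zero_mem' _ _ := MvPolynomial.coeff_zero _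
  smul_mem' c p hp m hm := by rw [MvPolynomial.coeff_smul, hp m hm, smul_zero]

theorem mem_degLT {j : ℕ} {p : Poly N} :
    p ∈ degLT j ↔ ∀ m : Fin N →₀ ℕ, j ≤ m.degree → p.coeff m = 0 :=
  Iff.rfl

/-- The strict degree bound makes `degLT 0` trivial: this is the base of the degree arguments, and
operators lowering the degree need no truncated subtraction. -/
theorem eq_zero_of_mem_degLT_zero {p : Poly N} (hp : p ∈ degLT 0) : p = 0 :=
  MvPolynomial.ext _ _ fun m => by simpa using hp m (Nat.zero_le _)

theorem degLT_mono {j l : ℕ} (h : j ≤ l) : (degLT j : Submodule ℝ (Poly N)) ≤ degLT l :=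
  fun _ hp m hm => hp m (h.trans hm)

theorem IsHomogeneous.mem_degLT {p : Poly N} {d j : ℕ} (hp : p.IsHomogeneous d) (h : d < j) :
    p ∈ degLT j := fun m hm => by
  by_contra hc
  have := hp.degree_eq_sum_deg_support (MvPolynomial.mem_support_iff.mpr hc)
  rw [← Finsupp.degree_apply] at this
  omega

theorem mem_degLT_succ_iff {p : Poly N} {j : ℕ} :
    p ∈ degLT (j + 1) ↔ p.totalDegree ≤ j := by
  rw [mem_degLT, MvPolynomial.totalDegree, Finset.sup_le_iff]
  refine forall_congr' fun m => ?_
  change _ ↔ (_ → m.degree ≤ j)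
  rw [MvPolynomial.mem_support_iff, ← not_imp_not, not_le, Nat.lt_succ_iff]

/-- The indices are asymmetric (degree at most `a` times degree less than `b`) so that `b = 0` is
covered. -/
theorem mul_mem_degLT {p q : Poly N} {a b : ℕ} (hp : p ∈ degLT (a + 1)) (hq : q ∈ degLT b) :
    p * q ∈ degLT (b + a) := fun m hm => by
  classical
  rw [MvPolynomial.coeff_mul]
  refine Finset.sum_eq_zero fun x hx => ?_
  have hd := congrArg Finsupp.degree (Finset.HasAntidiagonal.mem_antidiagonal.mp hx)
  rw [map_add] at hd
  by_cases h : a + 1 ≤ x.1.degree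
  · rw [hp _ h, zero_mul]
  · rw [hq _ (by omega), mul_zero]

theorem map_mem_degLT_of_monomial {f : Poly N →ₗ[ℝ] Poly N} {a b : ℕ}
    (h : ∀ m : Fin N →₀ ℕ, m.degree < a → f (MvPolynomial.monomial m 1) ∈ degLT b) {p : Poly N}
    (hp : p ∈ degLT a) : f p ∈ degLT b := by
  rw [← p.support_sum_monomial_coeff, map_sum]
  refine Submodule.sum_mem _ fun m hm => ?_
  have hm' : m.degree < a := by
    by_contra hc
    exact MvPolynomial.mem_support_iff.mp hm (hp m (by omega))
  have e : MvPolynomial.monomial m (p.coeff m) =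
      p.coeff m • (MvPolynomial.monomial m (1 : ℝ) : Poly N) := by
    rw [MvPolynomial.smul_monomial, smul_eq_mul, mul_one]
  rw [e, map_smul]
  exact Submodule.smul_mem _ _ (h m hm')

theorem isHomogeneous_monomial_one (m : Fin N →₀ ℕ) :
    (MvPolynomial.monomial m 1 : Poly N).IsHomogeneous m.degree :=
  MvPolynomial.isHomogeneous_monomial _ rfl

theorem X_mem_degLT (i : Fin N) : (MvPolynomial.X i : Poly N) ∈ degLT 2 :=
  IsHomogeneous.mem_degLT (MvPolynomial.isHomogeneous_X ℝ i) one_lt_two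

theorem pderiv_mem_degLT (i : Fin N) {p : Poly N} {j : ℕ} (hp : p ∈ degLT (j + 1)) :
    MvPolynomial.pderiv i p ∈ degLT j := by
  refine map_mem_degLT_of_monomial (f := (MvPolynomial.pderiv i).toLinearMap) (fun m hm => ?_) hp
  change MvPolynomial.pderiv i _ ∈ _
  rw [MvPolynomial.pderiv_monomial]
  by_cases h : m i = 0
  · simp [h]
  · refine IsHomogeneous.mem_degLT (MvPolynomial.isHomogeneous_monomial _ rfl) ?_
    have hle : Finsupp.single i 1 ≤ m := Finsupp.single_le_iff.mpr (by omega)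
    have := congrArg Finsupp.degree (tsub_add_cancel_of_le hle)
    rw [map_add, Finsupp.degree_single] at this
    omega

theorem isHomogeneous_linForm (v : Space N) : (linForm v).IsHomogeneous 1 := by
  refine MvPolynomial.IsHomogeneous.sum _ _ _ fun j _ => ?_
  simpa using (MvPolynomial.isHomogeneous_C (Fin N) (v j)).mul (MvPolynomial.isHomogeneous_X ℝ j)

theorem reflPoly_mem_degLT (v : Space N) {p : Poly N} {j : ℕ} (hp : p ∈ degLT j) :
    reflPoly v p ∈ degLT j := by
  refine map_mem_degLT_of_monomial (f := (reflPoly v).toLinearMap) (fun m hm => ?_) hp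
  have h := (isHomogeneous_monomial_one m).aeval (n := 1) (fun j : Fin N => MvPolynomial.X j -
    MvPolynomial.C (2 * v j / ‖v‖ ^ 2) * linForm v) fun j =>
      (MvPolynomial.isHomogeneous_X ℝ j).sub (by
        simpa using (MvPolynomial.isHomogeneous_C (Fin N) _).mul (isHomogeneous_linForm v))
  rw [one_mul] at h
  exact IsHomogeneous.mem_degLT h hm

theorem linForm_ne_zero {v : Space N} (hv : v ≠ 0) : linForm v ≠ 0 := by
  intro h0
  have h1 := evalAt_linForm v v
  rw [h0, real_inner_self_eq_norm_sq] at h1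
  exact hv (norm_eq_zero.mp (pow_eq_zero_iff two_ne_zero |>.mp (h1.symm.trans (map_zero _))))

/-- Degrees add in a domain, and the nonzero linear form has degree `1`, so dividing `p - σ_v p` by
it lowers the degree. -/
theorem divDiff_mem_degLT {v : Space N} (hv : v ≠ 0) {p : Poly N} {j : ℕ}
    (hp : p ∈ degLT (j + 1)) : divDiff v p ∈ degLT j := by
  by_cases h0 : divDiff v p = 0
  · rw [h0]
    exact Submodule.zero_mem _
  have h1 : linForm v * divDiff v p ∈ degLT (j + 1) := by
    rw [linForm_mul_divDiff]
    exact Submodule.sub_mem _ hp (reflPoly_mem_degLT v hp)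
  rw [mem_degLT_succ_iff, MvPolynomial.totalDegree_mul_of_isDomain (linForm_ne_zero hv) h0,
    (isHomogeneous_linForm v).totalDegree (linForm_ne_zero hv)] at h1
  obtain _ | j := j
  -- A nonzero multiple of the linear form cannot have degree `0`.
  · omega
  · exact mem_degLT_succ_iff.mpr (by omega)

theorem dunkl_mem_degLT {Rp : Finset (Space N)} (hRp : ∀ v ∈ Rp, v ≠ 0) (κ : Space N → ℝ)
    (i : Fin N) {p : Poly N} {j : ℕ} (hp : p ∈ degLT (j + 1)) : dunkl Rp κ i p ∈ degLT j := by
  rw [dunkl_apply]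
  exact Submodule.add_mem _ (pderiv_mem_degLT i hp) (Submodule.sum_mem _ fun v hv =>
    Submodule.smul_mem _ _ (divDiff_mem_degLT (hRp v hv) hp))

theorem dunkl_mem_degLT_self {Rp : Finset (Space N)} (hRp : ∀ v ∈ Rp, v ≠ 0) (κ : Space N → ℝ)
    (i : Fin N) {p : Poly N} {j : ℕ} (hp : p ∈ degLT j) : dunkl Rp κ i p ∈ degLT j :=
  dunkl_mem_degLT hRp κ i (degLT_mono (Nat.le_succ j) hp)

theorem euler_apply (p : Poly N) :
    euler p = ∑ i, MvPolynomial.X i * MvPolynomial.pderiv i p := by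
  simp [euler, LinearMap.sum_apply]

theorem euler_sub_mem_degLT {p : Poly N} {j : ℕ} (hp : p ∈ degLT (j + 1)) :
    euler p - (j : ℝ) • p ∈ degLT j := by
  refine map_mem_degLT_of_monomial (f := euler - (j : ℝ) • 1) (fun m hm => ?_) hp
  have h := (isHomogeneous_monomial_one m).sum_X_mul_pderiv
  rw [LinearMap.sub_apply, euler_apply, h, LinearMap.smul_apply, Module.End.one_apply,
    ← Nat.cast_smul_eq_nsmul ℝ, ← sub_smul]
  rcases Nat.lt_succ_iff_lt_or_eq.mp hm with h' | h'
  · exact Submodule.smul_mem _ _ (IsHomogeneous.mem_degLT (isHomogeneous_monomial_one m) h')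
  · rw [h', sub_self, zero_smul]
    exact Submodule.zero_mem _

theorem conjHamiltonian_apply (Rp : Finset (Space N)) (κ : Space N → ℝ) (ω : ℝ) (p : Poly N) :
    conjHamiltonian Rp κ ω p = -∑ i, dunkl Rp κ i (dunkl Rp κ i p) +
      ((ω * (N + 2 * gammaSum Rp κ)) • p + (2 * ω) • euler p) := by
  simp only [conjHamiltonian, dunklLaplacian, LinearMap.add_apply, LinearMap.neg_apply,
    LinearMap.smul_apply, LinearMap.sum_apply, pow_two, Module.End.mul_apply, Module.End.one_apply,
    smul_add, smul_smul, mul_comm ω 2]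

/-- Triangularity: `Δ_κ` lowers the degree, and `δ` acts on the top component of degree `j` as the
scalar `j`. -/
theorem conjHamiltonian_sub_mem_degLT {Rp : Finset (Space N)} (hRp : ∀ v ∈ Rp, v ≠ 0)
    (κ : Space N → ℝ) (ω : ℝ) {p : Poly N} {j : ℕ} (hp : p ∈ degLT (j + 1)) :
    conjHamiltonian Rp κ ω p - energy Rp κ ω j • p ∈ degLT j := by
  have e : conjHamiltonian Rp κ ω p - energy Rp κ ω j • p =
      -∑ i, dunkl Rp κ i (dunkl Rp κ i p) + (2 * ω) • (euler p - (j : ℝ) • p) := by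
    rw [conjHamiltonian_apply, energy]
    module
  rw [e]
  exact Submodule.add_mem _ (Submodule.neg_mem _ (Submodule.sum_mem _ fun i _ =>
    dunkl_mem_degLT_self hRp κ i (dunkl_mem_degLT hRp κ i hp)))
    (Submodule.smul_mem _ _ (euler_sub_mem_degLT hp))

theorem eq_of_energy_eq {Rp : Finset (Space N)} {κ : Space N → ℝ} {ω : ℝ} (hω : 0 < ω) {n k : ℕ}
    (h : energy Rp κ ω n = energy Rp κ ω k) : n = k := by
  unfold energy at h
  have := mul_left_cancel₀ hω.ne' h
  exact_mod_cast (by linarith : (n : ℝ) = k)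

/-- If the degree `d` of `p` differs from `n`, triangularity puts `(E_n - E_d) p` in degree less
than `d`, so `p` itself is there. -/
theorem mem_degLT_of_eigen {Rp : Finset (Space N)} (hRp : ∀ v ∈ Rp, v ≠ 0) {κ : Space N → ℝ}
    {ω : ℝ} (hω : 0 < ω) {n : ℕ} {p : Poly N}
    (hp : conjHamiltonian Rp κ ω p = energy Rp κ ω n • p) : p ∈ degLT (n + 1) := by
  have h0 : p ∈ degLT (p.totalDegree + 1) := mem_degLT_succ_iff.mpr le_rfl
  by_cases hn : n = p.totalDegree
  · rwa [hn]
  have h1 := conjHamiltonian_sub_mem_degLT hRp κ ω h0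
  rw [hp, ← sub_smul] at h1
  have h2 : p ∈ degLT p.totalDegree :=
    ((degLT _).smul_mem_iff (sub_ne_zero.mpr fun h => hn (eq_of_energy_eq hω h))).mp h1
  -- `totalDegree` is `0` for the zero polynomial as well, so degree `0` yields `p = 0` instead of a
  -- contradiction.
  rcases hd : p.totalDegree with _ | d
  · rw [hd] at h2
    rw [eq_zero_of_mem_degLT_zero h2]
    exact Submodule.zero_mem _
  · rw [hd, mem_degLT_succ_iff] at h2
    omega

theorem sub_homogeneousComponent_mem_degLT {p : Poly N} {n : ℕ} (hp : p ∈ degLT (n + 1)) :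
    p - MvPolynomial.homogeneousComponent n p ∈ degLT n := fun m hm => by
  rw [MvPolynomial.coeff_sub, MvPolynomial.coeff_homogeneousComponent]
  split_ifs with h
  · exact sub_self _
  · rw [hp m (by omega), sub_zero]

/-! ### Functionals for which `2ω x_i - D_i` is adjoint to `D_i` -/

/-- A reflection-invariant functional `I` such that `2ω x_i - D_i` is adjoint to `D_i` for the
form `(p, q) ↦ I (p q)`. -/
structure IsGaussian (Rp : Finset (Space N)) (κ : Space N → ℝ) (ω : ℝ) (I : Poly N →ₗ[ℝ] ℝ) :
    Prop where
  adjoint : ∀ i p q, I (dunkl Rp κ i p * q) + I (p * dunkl Rp κ i q) =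
    2 * ω * I (MvPolynomial.X i * (p * q))
  invariant : ∀ v ∈ Rp, ∀ p, I (reflPoly v p) = I p

/-- Summing `x_i v_i` over `i` restores the denominator `⟨x, v⟩` of the difference quotient. -/
theorem sum_X_mul_dunkl (Rp : Finset (Space N)) (κ : Space N → ℝ) (p : Poly N) :
    ∑ i, MvPolynomial.X i * dunkl Rp κ i p = euler p + ∑ v ∈ Rp, κ v • (p - reflPoly v p) := by
  simp only [dunkl_apply, mul_add, Finset.sum_add_distrib, euler_apply, Finset.mul_sum]
  congr 1
  rw [Finset.sum_comm]
  refine Finset.sum_congr rfl fun v _ => ?_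
  rw [← linForm_mul_divDiff, linForm, Finset.sum_mul, Finset.smul_sum]
  refine Finset.sum_congr rfl fun i _ => ?_
  simp only [MvPolynomial.smul_eq_C_mul, map_mul]
  ring

/-! ### Symmetry of the Hamiltonian and orthogonality -/

section

variable {Rp : Finset (Space N)} {κ : Space N → ℝ} {ω : ℝ} {I : Poly N →ₗ[ℝ] ℝ}

/-- Moving one `D_i` of each `D_i²` across produces `2ω ∑ x_i D_i`, whose Euler part cancels the
term `2ω δ` of the Hamiltonian. What remains is symmetric in `p` and `q` once reflections can be
moved across. -/
theorem IsGaussian.conjHamiltonian_mul (hI : IsGaussian Rp κ ω I) (p q : Poly N) :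
    I (conjHamiltonian Rp κ ω p * q) = ∑ i, I (dunkl Rp κ i p * dunkl Rp κ i q) +
      ω * (N + 2 * gammaSum Rp κ) * I (p * q) -
      2 * ω * ∑ v ∈ Rp, κ v * (I (p * q) - I (reflPoly v p * q)) := by
  have h1 : ∑ i, I (dunkl Rp κ i (dunkl Rp κ i p) * q) +
      ∑ i, I (dunkl Rp κ i p * dunkl Rp κ i q) =
      2 * ω * (I (euler p * q) + ∑ v ∈ Rp, κ v * (I (p * q) - I (reflPoly v p * q))) := by
    have h2 := congrArg (fun r => I (r * q)) (sum_X_mul_dunkl Rp κ p)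
    simp only [Finset.sum_mul, add_mul, map_add, map_sum, smul_mul_assoc, map_smul, sub_mul,
      map_sub, smul_eq_mul] at h2
    rw [← h2, ← Finset.sum_add_distrib, Finset.mul_sum]
    exact Finset.sum_congr rfl fun i _ => by rw [hI.adjoint, mul_assoc (MvPolynomial.X i)]
  rw [conjHamiltonian_apply]
  simp only [add_mul, neg_mul, Finset.sum_mul, smul_mul_assoc, map_add, map_neg, map_sum, map_smul,
    smul_eq_mul]
  linear_combination (-1 : ℝ) * h1

theorem IsGaussian.conjHamiltonian_symm (hI : IsGaussian Rp κ ω I) (p q : Poly N) :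
    I (conjHamiltonian Rp κ ω p * q) = I (p * conjHamiltonian Rp κ ω q) := by
  rw [mul_comm p, hI.conjHamiltonian_mul, hI.conjHamiltonian_mul]
  -- `σ_v` is an involution preserving `I`, hence self-adjoint.
  have h1 : ∀ v ∈ Rp, I (reflPoly v p * q) = I (reflPoly v q * p) := fun v hv => by
    rw [← hI.invariant v hv, map_mul, reflPoly_reflPoly, mul_comm]
  rw [mul_comm q p]
  congr 2
  · congr 1
    funext i
    rw [mul_comm]
  · exact Finset.sum_congr rfl fun v hv => by rw [h1 v hv]

theorem IsGaussian.eq_zero_of_eigen (hI : IsGaussian Rp κ ω I) (hω : 0 < ω) {n k : ℕ}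
    (hnk : n ≠ k) {p q : Poly N} (hp : conjHamiltonian Rp κ ω p = energy Rp κ ω n • p)
    (hq : conjHamiltonian Rp κ ω q = energy Rp κ ω k • q) : I (p * q) = 0 := by
  have h := hI.conjHamiltonian_symm p q
  rw [hp, hq, smul_mul_assoc, mul_smul_comm, map_smul, map_smul, ← sub_eq_zero, ← sub_smul] at h
  exact (smul_eq_zero.mp h).resolve_left (sub_ne_zero.mpr fun h => hnk (eq_of_energy_eq hω h))

/-- For `r` of degree at most `j < n`, the Hamiltonian sends `r` to `E_j r` plus lower terms, which
are orthogonal to `q` by induction. Symmetry then gives `(E_j - E_n) I (r q) = 0`, with no need for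
an eigenbasis. -/
theorem IsGaussian.eq_zero_of_mem_degLT (hI : IsGaussian Rp κ ω I) (hRp : ∀ v ∈ Rp, v ≠ 0)
    (hω : 0 < ω) {n : ℕ} {q : Poly N} (hq : conjHamiltonian Rp κ ω q = energy Rp κ ω n • q)
    {r : Poly N} (hr : r ∈ degLT n) : I (r * q) = 0 := by
  suffices h : ∀ j ≤ n, ∀ r ∈ degLT j, I (r * q) = 0 from h n le_rfl r hr
  intro j
  induction j with
  | zero =>
    intro _ r hr
    rw [eq_zero_of_mem_degLT_zero hr, zero_mul, map_zero]
  | succ j ih =>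
    intro hj r hr
    have h := ih (by omega) _ (conjHamiltonian_sub_mem_degLT hRp κ ω hr)
    rw [sub_mul, map_sub, hI.conjHamiltonian_symm, hq, smul_mul_assoc, mul_smul_comm, map_smul,
      map_smul, ← sub_smul] at h
    exact (smul_eq_zero.mp h).resolve_left
      (sub_ne_zero.mpr fun h => by have := eq_of_energy_eq hω h; omega)

/-! ### Moving monomials across the form -/

/-- The operator `A` lowers degrees by `d` and is adjoint, up to terms of lower degree, to the
multiplication by the polynomial `s` of degree `d`. -/
structure IsLeadingAdjoint (I : Poly N →ₗ[ℝ] ℝ) (d : ℕ) (s : Poly N) (A : Module.End ℝ (Poly N)) :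
    Prop where
  mem : s ∈ degLT (d + 1)
  map_mem : ∀ j, ∀ q ∈ degLT (j + d), A q ∈ degLT j
  orthogonal : ∀ n q, (∀ r ∈ degLT (n + d), I (r * q) = 0) → ∀ r ∈ degLT n, I (r * A q) = 0
  adjoint : ∀ n q, (∀ r ∈ degLT (n + d), I (r * q) = 0) → ∀ r ∈ degLT (n + 1),
    I (r * s * q) = I (r * A q)

theorem one_mem_degLT : (1 : Poly N) ∈ degLT 1 :=
  IsHomogeneous.mem_degLT (MvPolynomial.isHomogeneous_one _ _) one_pos

theorem IsLeadingAdjoint.one : IsLeadingAdjoint I 0 (1 : Poly N) 1 where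
  mem := one_mem_degLT
  map_mem _ _ h := h
  orthogonal _ _ h := h
  adjoint _ _ _ r _ := by rw [mul_one, Module.End.one_apply]

/-- The field `orthogonal` exists for this composition: `B q` must again be orthogonal to low
degrees before the rule for `A` applies to it. -/
theorem IsLeadingAdjoint.mul {d e : ℕ} {s t : Poly N} {A B : Module.End ℝ (Poly N)}
    (hs : IsLeadingAdjoint I d s A) (ht : IsLeadingAdjoint I e t B) :
    IsLeadingAdjoint I (d + e) (s * t) (A * B) where
  mem := by
    have h := mul_mem_degLT hs.mem ht.mem
    rwa [add_right_comm, add_comm e d] at h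
  map_mem j q hq := hs.map_mem j _ (ht.map_mem _ q (by rwa [add_assoc]))
  orthogonal n q hq := hs.orthogonal n _ (ht.orthogonal _ q (by rwa [add_assoc]))
  adjoint n q hq r hr := by
    rw [← add_assoc] at hq
    rw [Module.End.mul_apply, ← hs.adjoint n _ (ht.orthogonal _ q hq) r hr, ← mul_assoc,
      ht.adjoint (n + d) q hq (r * s) (by
        have h := mul_mem_degLT hs.mem hr
        rwa [mul_comm, add_right_comm] at h)]

theorem IsLeadingAdjoint.pow {s : Poly N} {A : Module.End ℝ (Poly N)}
    (hs : IsLeadingAdjoint I 1 s A) (m : ℕ) : IsLeadingAdjoint I m (s ^ m) (A ^ m) := by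
  induction m with
  | zero => exact IsLeadingAdjoint.one
  | succ m ih => exact ih.mul hs

theorem IsLeadingAdjoint.prod_ofFn {l : ℕ} {d : Fin l → ℕ} {s : Fin l → Poly N}
    {A : Fin l → Module.End ℝ (Poly N)} (h : ∀ i, IsLeadingAdjoint I (d i) (s i) (A i)) :
    IsLeadingAdjoint I (∑ i, d i) (∏ i, s i) (List.ofFn A).prod := by
  induction l with
  | zero => simpa using IsLeadingAdjoint.one
  | succ l ih =>
    rw [Fin.sum_univ_succ, Fin.prod_univ_succ, List.ofFn_succ, List.prod_cons]
    exact (h 0).mul (ih fun i => h i.succ)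

/-- In the adjoint relation the term `I (D_i r * q)` drops out, since `D_i r` has degree low enough
to be orthogonal to `q`. -/
theorem IsGaussian.isLeadingAdjoint_dunkl (hI : IsGaussian Rp κ ω I) (hRp : ∀ v ∈ Rp, v ≠ 0)
    (hω : 0 < ω) (i : Fin N) :
    IsLeadingAdjoint I 1 (MvPolynomial.X i) ((1 / (2 * ω)) • dunkl Rp κ i) where
  mem := X_mem_degLT i
  map_mem j q hq := Submodule.smul_mem _ _ (dunkl_mem_degLT hRp κ i hq)
  orthogonal n q hq r hr := by
    have h := hI.adjoint i r q
    rw [hq _ (dunkl_mem_degLT_self hRp κ i (degLT_mono (Nat.le_succ n) hr)), ← mul_assoc,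
      hq _ (mul_mem_degLT (X_mem_degLT i) hr), zero_add, mul_zero] at h
    rw [LinearMap.smul_apply, mul_smul_comm, map_smul, h, smul_zero]
  adjoint n q hq r hr := by
    have h := hI.adjoint i r q
    rw [hq _ (degLT_mono (Nat.le_succ n) (dunkl_mem_degLT hRp κ i hr)), zero_add] at h
    rw [LinearMap.smul_apply, mul_smul_comm, map_smul, h, smul_eq_mul, mul_comm r, mul_assoc]
    field_simp

theorem IsGaussian.isLeadingAdjoint_monomial (hI : IsGaussian Rp κ ω I) (hRp : ∀ v ∈ Rp, v ≠ 0)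
    (hω : 0 < ω) (m : Fin N →₀ ℕ) :
    IsLeadingAdjoint I m.degree (MvPolynomial.monomial m 1)
      (List.ofFn fun i => ((1 / (2 * ω)) • dunkl Rp κ i) ^ m i).prod := by
  have h := IsLeadingAdjoint.prod_ofFn fun i => (hI.isLeadingAdjoint_dunkl hRp hω i).pow (m i)
  rwa [← Finsupp.degree_eq_sum, show ∏ i, (MvPolynomial.X i : Poly N) ^ m i =
    MvPolynomial.monomial m 1 by
      rw [MvPolynomial.monomial_eq, map_one, one_mul, Finsupp.prod_fintype _ _ (by simp)]] at h

theorem apply_eq_of_mem_degLT_one {p : Poly N} (hp : p ∈ degLT 1) : I p = evalAt 0 p * I 1 := by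
  have h : p = MvPolynomial.C (p.coeff 0) := by
    refine MvPolynomial.ext _ _ fun m => ?_
    rw [MvPolynomial.coeff_C]
    split_ifs with h0
    · rw [h0]
    · exact hp m (Nat.one_le_iff_ne_zero.mpr fun h => h0 ((Finsupp.degree_eq_zero_iff m).mp h).symm)
  rw [h, ← mul_one (MvPolynomial.C _), ← MvPolynomial.smul_eq_C_mul, map_smul, evalAt_smul]
  simp [evalAt]

/-- The lower part of `p` drops out because `q` is orthogonal to it, the lower part of `q` because
the operators of order `n` kill it. -/
theorem IsGaussian.mul_eq_algebraicForm (hI : IsGaussian Rp κ ω I) (hRp : ∀ v ∈ Rp, v ≠ 0)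
    (hω : 0 < ω) {n : ℕ} {p q : Poly N} (hp : conjHamiltonian Rp κ ω p = energy Rp κ ω n • p)
    (hq : conjHamiltonian Rp κ ω q = energy Rp κ ω n • q) :
    I (p * q) = algebraicForm Rp κ ω (MvPolynomial.homogeneousComponent n p)
      (MvPolynomial.homogeneousComponent n q) * I 1 := by
  have hqo : ∀ r ∈ degLT n, I (r * q) = 0 := fun r hr => hI.eq_zero_of_mem_degLT hRp hω hq hr
  have hq1 := mem_degLT_of_eigen hRp hω hq
  have h0 := hqo _ (sub_homogeneousComponent_mem_degLT (mem_degLT_of_eigen hRp hω hp))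
  rw [sub_mul, map_sub, sub_eq_zero] at h0
  rw [h0]
  set P := MvPolynomial.homogeneousComponent n p with hP
  set Q := MvPolynomial.homogeneousComponent n q with hQ
  have hmon : ∀ m ∈ P.support, I (MvPolynomial.monomial m (P.coeff m) * q) =
      evalAt 0 ((P.coeff m • (List.ofFn fun i =>
        ((1 / (2 * ω)) • dunkl Rp κ i) ^ m i).prod) Q) * I 1 := fun m hm => by
    have hmd : m.degree = n := by
      have := (MvPolynomial.homogeneousComponent_isHomogeneous n p).degree_eq_sum_deg_support hm
      rw [← Finsupp.degree_apply] at this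
      exact this.symm
    have hA := hI.isLeadingAdjoint_monomial hRp hω m
    set A := (List.ofFn fun i => ((1 / (2 * ω)) • dunkl Rp κ i) ^ m i).prod
    rw [hmd] at hA
    -- With the test polynomial `1`, index `0` requires only that `q` be orthogonal to degree less
    -- than `n`.
    have h1 := hA.adjoint 0 q (by rwa [zero_add]) 1 one_mem_degLT
    have h2 := eq_zero_of_mem_degLT_zero (hA.map_mem 0 (q - Q)
      (by rw [zero_add]; exact sub_homogeneousComponent_mem_degLT hq1))
    rw [map_sub, sub_eq_zero] at h2
    -- `A Q` is a constant, so `I` sees only its value at the origin.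
    have h3 : A Q ∈ degLT 1 := hA.map_mem 1 Q (IsHomogeneous.mem_degLT
      (MvPolynomial.homogeneousComponent_isHomogeneous n q) (by omega))
    rw [one_mul, one_mul, h2, apply_eq_of_mem_degLT_one h3] at h1
    have e : MvPolynomial.monomial m (P.coeff m) =
        P.coeff m • (MvPolynomial.monomial m (1 : ℝ) : Poly N) := by
      rw [MvPolynomial.smul_monomial, smul_eq_mul, mul_one]
    rw [e, smul_mul_assoc, map_smul, h1, LinearMap.smul_apply, evalAt_smul, smul_eq_mul, mul_assoc]
  rw [algebraicForm, applyAt, LinearMap.sum_apply, evalAt, map_sum, Finset.sum_mul]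
  conv_lhs => rw [← P.support_sum_monomial_coeff, Finset.sum_mul, map_sum]
  exact Finset.sum_congr rfl hmon

end

/-! ### The Gaussian integral as an instance, and the conclusion -/

theorem isGaussian_gaussInt {R : Finset (Space N)} (hR : IsRootSystem R) {u₀ : Space N}
    (hu₀ : ∀ v ∈ R, inner ℝ u₀ v ≠ 0) {κ : Space N → ℝ} (hκ : IsMultiplicity R κ)
    (hκ' : ∀ v ∈ posRoots R u₀, 0 ≤ κ v) {ω : ℝ} (hω : 0 < ω) :
    IsGaussian (posRoots R u₀) κ ω (gaussInt (posRoots R u₀) κ hκ' hω) where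
  adjoint := gaussInt_dunkl_add hR hu₀ hκ hκ' hω
  invariant _ hv := gaussInt_reflPoly hR hu₀ hκ hκ' hω (mem_of_mem_posRoots hv)

end DunklOsc

theorem mainTheorem6 {N : ℕ} (R : Finset (DunklOsc.Space N)) (hR : DunklOsc.IsRootSystem R)
    (u₀ : DunklOsc.Space N) (hu₀ : ∀ v ∈ R, inner ℝ u₀ v ≠ 0)
    (κ : DunklOsc.Space N → ℝ) (hκ : DunklOsc.IsMultiplicity R κ) (hκ_nonneg : ∀ v ∈ R, 0 ≤ κ v)
    (ω : ℝ) (hω : 0 < ω) (n k : ℕ) (p q : DunklOsc.Poly N)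
    (hp : DunklOsc.conjHamiltonian (DunklOsc.posRoots R u₀) κ ω p =
      DunklOsc.energy (DunklOsc.posRoots R u₀) κ ω n • p)
    (hq : DunklOsc.conjHamiltonian (DunklOsc.posRoots R u₀) κ ω q =
      DunklOsc.energy (DunklOsc.posRoots R u₀) κ ω k • q) :
    (n = k →
      DunklOsc.integralForm (DunklOsc.posRoots R u₀) κ ω p q =
        DunklOsc.algebraicForm (DunklOsc.posRoots R u₀) κ ω
          (MvPolynomial.homogeneousComponent n p) (MvPolynomial.homogeneousComponent n q)) ∧
    (n ≠ k → DunklOsc.integralForm (DunklOsc.posRoots R u₀) κ ω p q = 0) := by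
  have hκ' : ∀ v ∈ DunklOsc.posRoots R u₀, 0 ≤ κ v := fun v hv =>
    hκ_nonneg v (DunklOsc.mem_of_mem_posRoots hv)
  have hI := DunklOsc.isGaussian_gaussInt hR hu₀ hκ hκ' hω
  have hRp : ∀ v ∈ DunklOsc.posRoots R u₀, v ≠ 0 := fun v hv =>
    hR.ne_zero v (DunklOsc.mem_of_mem_posRoots hv)
  rw [DunklOsc.integralForm_eq_gaussInt _ κ hκ' hω]
  refine ⟨fun h => ?_, fun h => ?_⟩
  · subst h
    rw [hI.mul_eq_algebraicForm hRp hω hp hq, mul_left_comm,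
      DunklOsc.normConst_mul_gaussInt_one R u₀ κ hκ_nonneg hκ' hω, mul_one]
  · rw [hI.eq_zero_of_eigen hω h hp hq, mul_zero]
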